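/- Let $M_1,M_2,N_1,N_2\ge 1$ be integers with $N:=M_1M_2=N_1N_2$, and let $\mathcal F:\mathbb C^{M_1}\otimes\mathbb C^{M_2}\to\mathbb C^{N_1}\otimes\mathbb C^{N_2}$ be the quantum Fourier transform, with matrix entries $$\langle j|\langle k|\,\mathcal F\,|\ell\rangle|m\rangle=\tfrac1{\sqrt N}\exp\!\Big(\tfrac{2\pi i}{N}(jN_2+k)(\ell M_2+m)\Big),$$ where $0\le j<N_1$, $0\le k<N_2$, $0\le \ell<M_1$, $0\le m<M_2$. A generalized operator-Schmidt decomposition of a nonzero linear map $F:\mathbb C^{M_1}\otimes\mathbb C^{M_2}\to\mathbb C^{N_1}\otimes\mathbb C^{N_2}$ is an expression $F=\sum_{k=1}^{r}\lambda_k A_k\otimes B_k$ with $\lambda_k>0$ and with $\{A_k\}$, $\{B_k\}$ orthonormal families, for the Hilbert–Schmidt inner product $\operatorname{Tr}C^\dagger D$, of linear maps $\mathbb C^{M_1}\to\mathbb C^{N_1}$ and $\mathbb C^{M_2}\to\mathbb C^{N_2}$ respectively; $r=\operatorname{Sch}(F)$ is the Schmidt number and the $\lambda_k$ are the Schmidt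 coefficients. The Schmidt strength of $F$ is the von Neumann entropy of the partial trace over the first factor of $|F\rangle\langle F|/\operatorname{Tr}(F^\dagger F)$, where $F$ is regarded as a vector of $B(\mathbb C^{M_1}\to\mathbb C^{N_1})\otimes B(\mathbb C^{M_2}\to\mathbb C^{N_2})$. $F$ is maximally entangled if its Schmidt strength is maximal among all nonzero $F$ between the same spaces; equivalently, if $\operatorname{Sch}(F)=\min(M_1N_1,M_2N_2)$ and all Schmidt coefficients are equal. The communication cost $Q_0(U)$ of a unitary $U$ between these spaces is the minimum of $\sum_{d\ge2}N_d\log_2 d$ over all two-party protocols that compute $U$ exactly by local operations (with ancilla) and the transmission, in either direction, of $N_d$ qudits of dimension $d$; Alice holds the first tensor factor and Bob the second, before and after the protocol. Then: 1. $\operatorname{Sch}(\mathcal F)=\min(M_1N_1,M_2N_2)$. 2. The communication cost of $\mathcal F$ is maximal: $Q_0(\mathcal F)=\log_2\min(M_1N_1,M_2N_2)$. 3. $\mathcal F$ is maximally entangled (in either of the two equivalent senses) if and only if ($M_1$ divides $N_2$ or $M_1>N_2$) and ($N_1$ divides $M_2$ or $N_1>M_2$). 4. If the condition in 3 fails, then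 $\mathcal F$ has at most four distinct Schmidt coefficients, and they are precisely the nonzero numbers among $\sqrt{\frac{N_1M_1}{N}\,a\,b}$ with $a\in\{\lceil N_2/M_1\rceil,\lfloor N_2/M_1\rfloor\}$ and $b\in\{\lceil M_2/N_1\rceil,\lfloor M_2/N_1\rfloor\}$. -/

import Mathlib

open scoped Kronecker

noncomputable section

/-! ### Generalized operator-Schmidt decompositions

A linear map `ℂ^a ⊗ ℂ^b → ℂ^a' ⊗ ℂ^b'` is given by its matrix in the product bases; rows are
indexed by `Fin a' × Fin b'`, columns by `Fin a × Fin b`, and `A ⊗ B` is the Kronecker product. -/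

/-- The Hilbert-Schmidt inner product `Tr (C† D)`. -/
def hsInner {a a' : ℕ} (C D : Matrix (Fin a') (Fin a) ℂ) : ℂ :=
  (C.conjTranspose * D).trace

/-- `F = ∑ₖ λₖ Aₖ ⊗ Bₖ` with `λₖ > 0` and with `(Aₖ)` and `(Bₖ)` orthonormal families for the
Hilbert-Schmidt inner product. -/
structure IsSchmidtDecomposition {a b a' b' : ℕ}
    (F : Matrix (Fin a' × Fin b') (Fin a × Fin b) ℂ) {r : ℕ} (lam : Fin r → ℝ)
    (A : Fin r → Matrix (Fin a') (Fin a) ℂ) (B : Fin r → Matrix (Fin b') (Fin b) ℂ) : Prop where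
  pos : ∀ k, 0 < lam k
  orthonormal_left : ∀ k l, hsInner (A k) (A l) = if k = l then 1 else 0
  orthonormal_right : ∀ k l, hsInner (B k) (B l) = if k = l then 1 else 0
  eq_sum : F = ∑ k, (lam k : ℂ) • (A k ⊗ₖ B k)

/-- `lam` is the family of Schmidt coefficients of some generalized operator-Schmidt
decomposition of `F`. -/
def AreSchmidtCoefficients {a b a' b' : ℕ}
    (F : Matrix (Fin a' × Fin b') (Fin a × Fin b) ℂ) {r : ℕ} (lam : Fin r → ℝ) : Prop :=
  ∃ (A : Fin r → Matrix (Fin a') (Fin a) ℂ) (B : Fin r → Matrix (Fin b') (Fin b) ℂ),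
    IsSchmidtDecomposition F lam A B

/-- `F` has a generalized operator-Schmidt decomposition with exactly `r` terms. -/
def HasSchmidtNumber {a b a' b' : ℕ}
    (F : Matrix (Fin a' × Fin b') (Fin a × Fin b) ℂ) (r : ℕ) : Prop :=
  ∃ lam : Fin r → ℝ, AreSchmidtCoefficients F lam

/-! ### Schmidt strength and maximally entangled operators -/

/-- The coefficients of `F` as a vector of `B(ℂ^a → ℂ^a') ⊗ B(ℂ^b → ℂ^b')` in the basis of matrix
units; rows are indexed by the units of the second factor, columns by those of the first. -/
def reshuffle {a b a' b' : ℕ} (F : Matrix (Fin a' × Fin b') (Fin a × Fin b) ℂ) :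
    Matrix (Fin b' × Fin b) (Fin a' × Fin a) ℂ :=
  Matrix.of fun p q => F (q.1, p.1) (q.2, p.2)

/-- The partial trace of `|F⟩⟨F|` over the first factor `B(ℂ^a → ℂ^a')`, normalized to trace one. -/
def reducedState {a b a' b' : ℕ} (F : Matrix (Fin a' × Fin b') (Fin a × Fin b) ℂ) :
    Matrix (Fin b' × Fin b) (Fin b' × Fin b) ℂ :=
  ((reshuffle F * (reshuffle F).conjTranspose).trace.re)⁻¹ •
    (reshuffle F * (reshuffle F).conjTranspose)

theorem reducedState_isHermitian {a b a' b' : ℕ}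
    (F : Matrix (Fin a' × Fin b') (Fin a × Fin b) ℂ) : (reducedState F).IsHermitian := by
  unfold reducedState
  rw [Matrix.IsHermitian, Matrix.conjTranspose_smul, Matrix.conjTranspose_mul,
    Matrix.conjTranspose_conjTranspose, star_trivial]

/-- The von Neumann entropy `S(ρ) = -Tr (ρ log ρ)`, the sum of `-p log p` over the eigenvalues `p`
of `ρ`. -/
def vonNeumannEntropy {ι : Type} [Fintype ι] [DecidableEq ι] (ρ : Matrix ι ι ℂ)
    (hρ : ρ.IsHermitian) : ℝ :=
  ∑ i, Real.negMulLog (hρ.eigenvalues i)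

/-- The Schmidt strength: the entanglement entropy of (the normalization of) `F` as a vector of
`B(ℂ^a → ℂ^a') ⊗ B(ℂ^b → ℂ^b')`. -/
def schmidtStrength {a b a' b' : ℕ} (F : Matrix (Fin a' × Fin b') (Fin a × Fin b) ℂ) : ℝ :=
  vonNeumannEntropy (reducedState F) (reducedState_isHermitian F)

/-- `F` maximizes the Schmidt strength among all nonzero linear maps
`ℂ^a ⊗ ℂ^b → ℂ^a' ⊗ ℂ^b'`. -/
def IsMaximallyEntangled {a b a' b' : ℕ}
    (F : Matrix (Fin a' × Fin b') (Fin a × Fin b) ℂ) : Prop :=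
  F ≠ 0 ∧ ∀ G : Matrix (Fin a' × Fin b') (Fin a × Fin b) ℂ, G ≠ 0 →
    schmidtStrength G ≤ schmidtStrength F

/-! ### Two-party quantum protocols and communication cost -/

/-- A (trace preserving) quantum operation from `ℂ^a` to `ℂ^c`, through Kraus operators. It covers
unitaries, the introduction of ancilla (isometries), measurements, and discarding subsystems. -/
structure QuantumOperation (a c : ℕ) where
  /-- the number of Kraus operators -/
  size : ℕ
  /-- the Kraus operators -/
  kraus : Fin size → Matrix (Fin c) (Fin a) ℂ
  trace_preserving : ∑ i, (kraus i).conjTranspose * kraus i = 1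

/-- `Protocol a' b' a b`: a protocol that starts with Alice holding `ℂ^a` and Bob holding `ℂ^b`, and
ends with Alice holding `ℂ^a'` and Bob holding `ℂ^b'`. It is a finite sequence of local operations
and of transmissions of qudits. -/
inductive Protocol (a' b' : ℕ) : ℕ → ℕ → Type
  | done : Protocol a' b' a' b'
  | aliceLocal {a b c : ℕ} (E : QuantumOperation a c) (P : Protocol a' b' c b) :
      Protocol a' b' a b
  | bobLocal {a b c : ℕ} (E : QuantumOperation b c) (P : Protocol a' b' a c) :
      Protocol a' b' a b
  | aliceSends {a b : ℕ} (d : ℕ) (hd : 2 ≤ d) (P : Protocol a' b' a (d * b)) :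
      Protocol a' b' (a * d) b
  | bobSends {a b : ℕ} (d : ℕ) (hd : 2 ≤ d) (P : Protocol a' b' (a * d) b) :
      Protocol a' b' a (d * b)

/-- The communication operator `(ℂ^a ⊗ ℂ^d) ⊗ ℂ^b → ℂ^a ⊗ (ℂ^d ⊗ ℂ^b)` on basis labels. -/
def regroup (a d b : ℕ) : Fin (a * d) × Fin b ≃ Fin a × Fin (d * b) :=
  ((Equiv.prodCongr finProdFinEquiv.symm (Equiv.refl (Fin b))).trans
    (Equiv.prodAssoc (Fin a) (Fin d) (Fin b))).trans
    (Equiv.prodCongr (Equiv.refl (Fin a)) finProdFinEquiv)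

/-- The final joint state of a protocol as a function of the initial joint state `ρ`. -/
def Protocol.run {a' b' : ℕ} : {a b : ℕ} → Protocol a' b' a b →
    Matrix (Fin a × Fin b) (Fin a × Fin b) ℂ → Matrix (Fin a' × Fin b') (Fin a' × Fin b') ℂ
  | _, _, .done, ρ => ρ
  | _, b, .aliceLocal E P, ρ =>
      P.run (∑ i, (E.kraus i ⊗ₖ (1 : Matrix (Fin b) (Fin b) ℂ)) * ρ *
        (E.kraus i ⊗ₖ (1 : Matrix (Fin b) (Fin b) ℂ)).conjTranspose)
  | a, _, .bobLocal E P, ρ =>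
      P.run (∑ i, ((1 : Matrix (Fin a) (Fin a) ℂ) ⊗ₖ E.kraus i) * ρ *
        ((1 : Matrix (Fin a) (Fin a) ℂ) ⊗ₖ E.kraus i).conjTranspose)
  | _, _, .aliceSends d _ P, ρ => P.run (Matrix.reindex (regroup _ d _) (regroup _ d _) ρ)
  | _, _, .bobSends d _ P, ρ =>
      P.run (Matrix.reindex (regroup _ d _).symm (regroup _ d _).symm ρ)

/-- The number of qudits of each dimension `d` that a protocol transmits, in either direction. -/
def Protocol.transmitted {a' b' : ℕ} : {a b : ℕ} → Protocol a' b' a b → (ℕ →₀ ℕ)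
  | _, _, .done => 0
  | _, _, .aliceLocal _ P => P.transmitted
  | _, _, .bobLocal _ P => P.transmitted
  | _, _, .aliceSends d _ P => Finsupp.single d 1 + P.transmitted
  | _, _, .bobSends d _ P => Finsupp.single d 1 + P.transmitted

/-- The cost `∑ N_d log₂ d` of a protocol. -/
def Protocol.cost {a' b' a b : ℕ} (P : Protocol a' b' a b) : ℝ :=
  P.transmitted.sum fun d n => (n : ℝ) * Real.logb 2 (d : ℝ)

/-- The protocol computes `U` exactly: it maps every `ρ` to `U ρ U†`. -/
def Protocol.Computes {a' b' a b : ℕ} (P : Protocol a' b' a b)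
    (U : Matrix (Fin a' × Fin b') (Fin a × Fin b) ℂ) : Prop :=
  ∀ ρ : Matrix (Fin a × Fin b) (Fin a × Fin b) ℂ, P.run ρ = U * ρ * U.conjTranspose

/-- `q` is the communication cost of `U`: the minimum of the costs of all protocols that
compute `U`. -/
def IsCommunicationCost {a' b' a b : ℕ} (U : Matrix (Fin a' × Fin b') (Fin a × Fin b) ℂ)
    (q : ℝ) : Prop :=
  IsLeast {c : ℝ | ∃ P : Protocol a' b' a b, P.Computes U ∧ P.cost = c} q

/-- The communication cost of `U : ℂ^a ⊗ ℂ^b → ℂ^a' ⊗ ℂ^b'` is maximal. -/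
def HasMaximalCommunicationCost {a' b' a b : ℕ}
    (U : Matrix (Fin a' × Fin b') (Fin a × Fin b) ℂ) : Prop :=
  IsCommunicationCost U (Real.logb 2 ((min (a * a') (b * b') : ℕ) : ℝ))

/-! ### The quantum Fourier transform -/

/-- The quantum Fourier transform `ℂ^M₁ ⊗ ℂ^M₂ → ℂ^N₁ ⊗ ℂ^N₂`, for `N = N₁ N₂ = M₁ M₂`. -/
def bipartiteQFT (M₁ M₂ N₁ N₂ : ℕ) : Matrix (Fin N₁ × Fin N₂) (Fin M₁ × Fin M₂) ℂ :=
  Matrix.of fun x y =>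
    ((1 / Real.sqrt ((N₁ * N₂ : ℕ) : ℝ) : ℝ) : ℂ) *
      Complex.exp (2 * (Real.pi : ℂ) * Complex.I / ((N₁ * N₂ : ℕ) : ℂ) *
        (((x.1 : ℕ) * N₂ + (x.2 : ℕ) : ℕ) : ℂ) * (((y.1 : ℕ) * M₂ + (y.2 : ℕ) : ℕ) : ℂ))

/-- `(M₁ ∣ N₂` or `M₁ > N₂)` and `(N₁ ∣ M₂` or `N₁ > M₂)`. -/
def FlatnessCondition (M₁ M₂ N₁ N₂ : ℕ) : Prop :=
  (M₁ ∣ N₂ ∨ M₁ > N₂) ∧ (N₁ ∣ M₂ ∨ N₁ > M₂)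

/-- The nonzero numbers among `√(N₁ M₁ a b / N)`, with `a` the ceiling or the floor of `N₂ / M₁` and
`b` the ceiling or the floor of `M₂ / N₁`. -/
def fourCoefficients (M₁ M₂ N₁ N₂ : ℕ) : Set ℝ :=
  {x : ℝ | x ≠ 0 ∧
    ∃ a ∈ ({⌈(N₂ : ℝ) / (M₁ : ℝ)⌉₊, ⌊(N₂ : ℝ) / (M₁ : ℝ)⌋₊} : Set ℕ),
    ∃ b ∈ ({⌈(M₂ : ℝ) / (N₁ : ℝ)⌉₊, ⌊(M₂ : ℝ) / (N₁ : ℝ)⌋₊} : Set ℕ),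
      x = Real.sqrt (((N₁ : ℝ) * (M₁ : ℝ)) / ((N₁ : ℝ) * (N₂ : ℝ)) * ((a : ℝ) * (b : ℝ)))}

end

/-! With `ω = exp (2πi/N)`, the exponent `(jN₂+k)(ℓM₂+m)` splits as `jℓN₂M₂ + jmN₂ + kℓM₂ + km`. The
outer terms are local phases. Since `ω ^ N₂` and `ω ^ M₂` have orders `N₁` and `M₁`, the cross terms
see `m` and `k` only through `r = m % N₁` and `s = k % M₁`. Sorting the entries `(k, m)` by `(r, s)`
gives `bipartiteQFT_eq_sum`. The left operators are a common phase times characters in `j` and `ℓ`,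
hence orthogonal; the right operators have disjoint supports. After normalization the squared
coefficients are `N₁M₁/N` times the product of two residue class sizes. These sizes decide flatness,
and the nonempty classes number `min N₁ M₂ * min M₁ N₂ = min (M₁N₁) (M₂N₂)`.

A Schmidt decomposition of `F` is a singular value decomposition of `reshuffle F`, so its length and
its set of coefficients depend on `F` alone (`rank_eq`, `range_eq`). Gibbs' inequality bounds the
Schmidt strength by the logarithm of the smaller dimension, and equality forces equal coefficients.

For the communication cost, sending a qudit of dimension `d` multiplies by `d` the number of product
terms needed for each Kraus operator. If the protocol computes `U`, then `U` is a multiple of one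
Kraus operator, so the rank of `reshuffle U` is at most `2 ^ cost`. The bound is attained by sending
one party's input across, applying `U` there and returning the output. -/

/-! ### Schmidt decompositions as singular value decompositions -/

/-- The matrix whose columns are the vectorizations of the family `B`. -/
def vecMatrix {r c c' : ℕ} (B : Fin r → Matrix (Fin c') (Fin c) ℂ) :
    Matrix (Fin c' × Fin c) (Fin r) ℂ :=
  Matrix.of fun p k => B k p.1 p.2

theorem vecMatrix_conjTranspose_mul {r c c' : ℕ} {B : Fin r → Matrix (Fin c') (Fin c) ℂ}
    (hB : ∀ k l, hsInner (B k) (B l) = if k = l then 1 else 0) :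
    (vecMatrix B).conjTranspose * vecMatrix B = 1 := by
  ext k l
  rw [Matrix.one_apply, ← hB k l, hsInner, Matrix.trace, Matrix.mul_apply, Fintype.sum_prod_type,
    Finset.sum_comm]
  simp [vecMatrix, Matrix.mul_apply]

/-- Reshuffling turns `A ⊗ B` into the rank-one matrix `vec B (vec A)ᵀ`, so a sum of products
becomes a matrix factorization. -/
theorem reshuffle_sum_kronecker {a b a' b' r : ℕ} (lam : Fin r → ℂ)
    (A : Fin r → Matrix (Fin a') (Fin a) ℂ) (B : Fin r → Matrix (Fin b') (Fin b) ℂ) :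
    reshuffle (∑ k, lam k • (A k ⊗ₖ B k)) =
      vecMatrix B * Matrix.diagonal lam * (vecMatrix A).transpose := by
  ext p q
  rw [Matrix.mul_apply]
  simp only [reshuffle, vecMatrix, Matrix.of_apply, Matrix.sum_apply, Matrix.smul_apply,
    Matrix.kroneckerMap_apply, Matrix.mul_diagonal, Matrix.transpose_apply, smul_eq_mul]
  exact Finset.sum_congr rfl fun k _ => by ring

section SchmidtDecomposition

variable {a b a' b' r : ℕ} {F : Matrix (Fin a' × Fin b') (Fin a × Fin b) ℂ} {lam : Fin r → ℝ}
  {A : Fin r → Matrix (Fin a') (Fin a) ℂ} {B : Fin r → Matrix (Fin b') (Fin b) ℂ}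

theorem IsSchmidtDecomposition.reshuffle_eq (h : IsSchmidtDecomposition F lam A B) :
    reshuffle F =
      vecMatrix B * Matrix.diagonal (fun k => (lam k : ℂ)) * (vecMatrix A).transpose := by
  rw [← reshuffle_sum_kronecker, ← h.eq_sum]

theorem IsSchmidtDecomposition.vecMatrix_transpose_mul (h : IsSchmidtDecomposition F lam A B) :
    (vecMatrix A).transpose * (vecMatrix A).transpose.conjTranspose = 1 := by
  have := congrArg Matrix.transpose (vecMatrix_conjTranspose_mul h.orthonormal_left)
  rwa [Matrix.transpose_mul, Matrix.transpose_one] at this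

theorem IsSchmidtDecomposition.reshuffle_mul_conjTranspose
    (h : IsSchmidtDecomposition F lam A B) :
    reshuffle F * (reshuffle F).conjTranspose =
      vecMatrix B * Matrix.diagonal (fun k => (lam k : ℂ) ^ 2) * (vecMatrix B).conjTranspose := by
  have hd : (Matrix.diagonal fun k => (lam k : ℂ)).conjTranspose =
      Matrix.diagonal fun k => (lam k : ℂ) := by
    rw [Matrix.diagonal_conjTranspose]
    congr 1
    ext k
    simp
  calc reshuffle F * (reshuffle F).conjTranspose
      = vecMatrix B * Matrix.diagonal (fun k => (lam k : ℂ)) *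
          ((vecMatrix A).transpose * (vecMatrix A).transpose.conjTranspose) *
          Matrix.diagonal (fun k => (lam k : ℂ)) * (vecMatrix B).conjTranspose := by
        rw [h.reshuffle_eq, Matrix.conjTranspose_mul, Matrix.conjTranspose_mul, hd]
        simp only [Matrix.mul_assoc]
    _ = _ := by
        rw [h.vecMatrix_transpose_mul, Matrix.mul_one, Matrix.mul_assoc (vecMatrix B),
          Matrix.diagonal_mul_diagonal]
        simp only [sq]

/-- The factor matrices are isometries; compressing by their adjoints recovers the invertible
diagonal. Hence the Schmidt number is intrinsic. -/
theorem IsSchmidtDecomposition.rank_eq (h : IsSchmidtDecomposition F lam A B) :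
    (reshuffle F).rank = r := by
  apply le_antisymm
  · rw [h.reshuffle_eq, Matrix.mul_assoc]
    refine (Matrix.rank_mul_le_left _ _).trans ?_
    simpa using Matrix.rank_le_card_width (vecMatrix B)
  · have key : (vecMatrix B).conjTranspose * reshuffle F *
        (vecMatrix A).transpose.conjTranspose = Matrix.diagonal fun k => (lam k : ℂ) := by
      calc _ = ((vecMatrix B).conjTranspose * vecMatrix B) *
            Matrix.diagonal (fun k => (lam k : ℂ)) *
            ((vecMatrix A).transpose * (vecMatrix A).transpose.conjTranspose) := by
            rw [h.reshuffle_eq]; simp only [Matrix.mul_assoc]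
        _ = _ := by
            rw [h.vecMatrix_transpose_mul, vecMatrix_conjTranspose_mul h.orthonormal_right,
              Matrix.mul_one, Matrix.one_mul]
    have hr : (Matrix.diagonal fun k => (lam k : ℂ)).rank = r := by
      rw [Matrix.rank_diagonal, Fintype.card_subtype, Finset.filter_true_of_mem]
      · simp
      · intro k _
        exact_mod_cast (h.pos k).ne'
    calc r = _ := hr.symm
      _ ≤ ((vecMatrix B).conjTranspose * reshuffle F).rank := by
        rw [← key]; exact Matrix.rank_mul_le_left _ _
      _ ≤ _ := Matrix.rank_mul_le_right _ _

/-- The right-hand operator of the eigenvalue equation is `V D V†` with `V` an isometry, so its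
eigenvectors for nonzero eigenvalues come from those of `D`. The value `0` is excluded because the
orthogonal complement of the range of `V` may contribute it. -/
theorem IsSchmidtDecomposition.exists_eigenvector_iff (h : IsSchmidtDecomposition F lam A B)
    (z : ℂ) :
    (z ≠ 0 ∧ ∃ w : Fin b' × Fin b → ℂ, w ≠ 0 ∧
      (reshuffle F * (reshuffle F).conjTranspose).mulVec w = z • w) ↔
      ∃ k, z = (lam k : ℂ) ^ 2 := by
  rw [h.reshuffle_mul_conjTranspose]
  have hB := vecMatrix_conjTranspose_mul h.orthonormal_right
  constructor
  · rintro ⟨hz, w, hw, he⟩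
    set c := (vecMatrix B).conjTranspose.mulVec w with hc
    have h1 : (Matrix.diagonal fun k => (lam k : ℂ) ^ 2).mulVec c = z • c := by
      have := congrArg (vecMatrix B).conjTranspose.mulVec he
      rw [Matrix.mulVec_smul, Matrix.mulVec_mulVec, ← Matrix.mul_assoc, ← Matrix.mul_assoc, hB,
        Matrix.one_mul, ← Matrix.mulVec_mulVec] at this
      exact this
    have hc0 : c ≠ 0 := by
      intro h0
      rw [← Matrix.mulVec_mulVec, ← hc, h0, Matrix.mulVec_zero] at he
      exact (smul_ne_zero hz hw) he.symm
    obtain ⟨k, hk⟩ := Function.ne_iff.mp hc0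
    refine ⟨k, ?_⟩
    have h2 := congrFun h1 k
    rw [Matrix.mulVec_diagonal, Pi.smul_apply, smul_eq_mul] at h2
    exact (mul_right_cancel₀ hk h2).symm
  · rintro ⟨k, rfl⟩
    refine ⟨pow_ne_zero 2 (by exact_mod_cast (h.pos k).ne'), (vecMatrix B).mulVec (Pi.single k 1),
      ?_, ?_⟩
    · intro h0
      have := congrArg (vecMatrix B).conjTranspose.mulVec h0
      rw [Matrix.mulVec_mulVec, hB, Matrix.one_mulVec, Matrix.mulVec_zero] at this
      simpa using congrFun this k
    · rw [Matrix.mulVec_mulVec, Matrix.mul_assoc, hB, Matrix.mul_one, ← Matrix.mulVec_mulVec,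
        ← Matrix.mulVec_smul]
      congr 1
      ext l
      rw [Matrix.mulVec_diagonal]
      by_cases hl : l = k
      · subst hl; simp
      · simp [hl]

end SchmidtDecomposition

theorem AreSchmidtCoefficients.rank_eq {a b a' b' r : ℕ}
    {F : Matrix (Fin a' × Fin b') (Fin a × Fin b) ℂ} {lam : Fin r → ℝ}
    (h : AreSchmidtCoefficients F lam) : (reshuffle F).rank = r := by
  obtain ⟨A, B, h⟩ := h
  exact h.rank_eq

theorem AreSchmidtCoefficients.range_subset {a b a' b' r s : ℕ}
    {F : Matrix (Fin a' × Fin b') (Fin a × Fin b) ℂ} {lam : Fin r → ℝ} {mu : Fin s → ℝ}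
    (h : AreSchmidtCoefficients F lam) (h' : AreSchmidtCoefficients F mu) :
    Set.range lam ⊆ Set.range mu := by
  obtain ⟨A, B, h⟩ := h
  obtain ⟨A', B', h'⟩ := h'
  rintro _ ⟨k, rfl⟩
  obtain ⟨l, hl⟩ := (h'.exists_eigenvector_iff _).mp ((h.exists_eigenvector_iff _).mpr ⟨k, rfl⟩)
  refine ⟨l, ?_⟩
  have : lam k ^ 2 = mu l ^ 2 := by exact_mod_cast hl
  exact ((pow_left_inj₀ (h.pos k).le (h'.pos l).le two_ne_zero).mp this).symm

theorem AreSchmidtCoefficients.range_eq {a b a' b' r s : ℕ}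
    {F : Matrix (Fin a' × Fin b') (Fin a × Fin b) ℂ} {lam : Fin r → ℝ} {mu : Fin s → ℝ}
    (h : AreSchmidtCoefficients F lam) (h' : AreSchmidtCoefficients F mu) :
    Set.range lam = Set.range mu :=
  (h.range_subset h').antisymm (h'.range_subset h)

/-- A generalized operator-Schmidt decomposition indexed by an arbitrary finite type. -/
theorem areSchmidtCoefficients_of_fintype {a b a' b' : ℕ} {ι : Type*} [Fintype ι] [DecidableEq ι]
    {F : Matrix (Fin a' × Fin b') (Fin a × Fin b) ℂ} {r : ℕ} (e : Fin r ≃ ι) {lam : ι → ℝ}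
    {A : ι → Matrix (Fin a') (Fin a) ℂ} {B : ι → Matrix (Fin b') (Fin b) ℂ}
    (pos : ∀ k, 0 < lam k)
    (hA : ∀ k l, hsInner (A k) (A l) = if k = l then 1 else 0)
    (hB : ∀ k l, hsInner (B k) (B l) = if k = l then 1 else 0)
    (hF : F = ∑ k, (lam k : ℂ) • (A k ⊗ₖ B k)) :
    AreSchmidtCoefficients F (lam ∘ e) :=
  ⟨A ∘ e, B ∘ e, fun k => pos _, fun k l => by simp [hA], fun k l => by simp [hB], by
    rw [hF, ← e.sum_comp]; rfl⟩

/-! ### Schmidt strength and maximal entanglement -/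

theorem trace_reshuffle_mul_conjTranspose_pos {a b a' b' : ℕ}
    {F : Matrix (Fin a' × Fin b') (Fin a × Fin b) ℂ} (hF : F ≠ 0) :
    0 < (reshuffle F * (reshuffle F).conjTranspose).trace.re := by
  open scoped ComplexOrder in
  have h0 := (Matrix.posSemidef_self_mul_conjTranspose (reshuffle F)).trace_nonneg
  have h1 : (reshuffle F * (reshuffle F).conjTranspose).trace ≠ 0 := by
    intro h
    rw [Matrix.trace_mul_conjTranspose_self_eq_zero_iff] at h
    refine hF (Matrix.ext fun x y => ?_)
    exact congrFun (congrFun h (x.2, y.2)) (x.1, y.1)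
  rw [Complex.le_def] at h0
  refine lt_of_le_of_ne h0.1 fun h => h1 ?_
  exact Complex.ext h.symm h0.2.symm

theorem reducedState_eigenvalues_nonneg {a b a' b' : ℕ}
    {F : Matrix (Fin a' × Fin b') (Fin a × Fin b) ℂ} (hF : F ≠ 0) (i : Fin b' × Fin b) :
    0 ≤ (reducedState_isHermitian F).eigenvalues i := by
  open scoped ComplexOrder in
  have h : (reducedState F).PosSemidef :=
    (Matrix.posSemidef_self_mul_conjTranspose (reshuffle F)).smul
      (inv_nonneg.mpr (trace_reshuffle_mul_conjTranspose_pos hF).le)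
  exact h.eigenvalues_nonneg i

theorem sum_reducedState_eigenvalues {a b a' b' : ℕ}
    {F : Matrix (Fin a' × Fin b') (Fin a × Fin b) ℂ} (hF : F ≠ 0) :
    ∑ i, (reducedState_isHermitian F).eigenvalues i = 1 := by
  have h := congrArg Complex.re (reducedState_isHermitian F).trace_eq_sum_eigenvalues
  rw [Complex.re_sum] at h
  simp only [Complex.coe_algebraMap, Complex.ofReal_re] at h
  refine Eq.trans ?_ (h.symm.trans ?_)
  · rfl
  · rw [reducedState, Matrix.trace_smul, Complex.smul_re, smul_eq_mul,
      inv_mul_cancel₀ (trace_reshuffle_mul_conjTranspose_pos hF).ne']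

theorem card_reducedState_eigenvalues_ne_zero_le {a b a' b' : ℕ}
    (F : Matrix (Fin a' × Fin b') (Fin a × Fin b) ℂ) :
    Fintype.card {i // (reducedState_isHermitian F).eigenvalues i ≠ 0} ≤
      min (a * a') (b * b') := by
  rw [← Matrix.IsHermitian.rank_eq_card_non_zero_eigs]
  have h1 : (reducedState F).rank ≤ (reshuffle F).rank := by
    -- With the scalar absorbed into the left factor, the bound also covers `F = 0`, where the
    -- scalar vanishes.
    rw [reducedState, ← Matrix.smul_mul]
    refine (Matrix.rank_mul_le_right _ _).trans ?_
    open scoped ComplexOrder in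
    rw [Matrix.rank_conjTranspose]
  refine h1.trans (le_min ?_ ?_)
  · simpa [mul_comm] using Matrix.rank_le_card_width (reshuffle F)
  · simpa [mul_comm] using Matrix.rank_le_card_height (reshuffle F)

/-- Gibbs' inequality for a distribution with at most `d` nonzero weights, with the case of
equality. -/
theorem sum_negMulLog_le_log {ι : Type*} [Fintype ι] {p : ι → ℝ} (hp : ∀ i, 0 ≤ p i)
    (hsum : ∑ i, p i = 1) {d : ℕ} (hd : Fintype.card {i // p i ≠ 0} ≤ d) :
    ∑ i, Real.negMulLog (p i) ≤ Real.log d ∧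
      (∑ i, Real.negMulLog (p i) = Real.log d → ∀ i, p i ≠ 0 → p i = (d : ℝ)⁻¹) := by
  classical
  have hd0 : 0 < d := by
    rcases Nat.eq_zero_or_pos d with rfl | h
    · have := Fintype.card_eq_zero_iff.mp (Nat.le_zero.mp hd)
      have h0 : ∀ i, p i = 0 := fun i => by
        by_contra hi
        exact this.elim ⟨i, hi⟩
      simp [h0] at hsum
    · exact h
  have hdR : (0 : ℝ) < d := by exact_mod_cast hd0
  have hterm : ∀ i, p i ≠ 0 → Real.negMulLog (p i) - p i * Real.log d =
      p i * Real.log ((d : ℝ)⁻¹ / p i) := by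
    intro i hi
    rw [Real.log_div (inv_ne_zero hdR.ne') hi, Real.log_inv, Real.negMulLog]
    ring
  -- This is `log x ≤ x - 1` at `x = 1 / (d * p i)`. The uniform weight `1 / d` is kept only on the
  -- support of `p`, where at most `d` copies occur.
  have hle : ∀ i, Real.negMulLog (p i) - p i * Real.log d ≤
      (if p i ≠ 0 then (d : ℝ)⁻¹ else 0) - p i := by
    intro i
    by_cases hi : p i = 0
    · simp [hi]
    · have hpos : 0 < p i := lt_of_le_of_ne (hp i) (Ne.symm hi)
      rw [hterm i hi, if_pos hi]
      have := mul_le_mul_of_nonneg_left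
        (Real.log_le_sub_one_of_pos (div_pos (inv_pos.mpr hdR) hpos)) hpos.le
      rwa [mul_sub, mul_div_cancel₀ _ hi, mul_one] at this
  have hright : ∑ i, ((if p i ≠ 0 then (d : ℝ)⁻¹ else 0) - p i) ≤ 0 := by
    rw [Finset.sum_sub_distrib, hsum, ← Finset.sum_filter, Finset.sum_const, nsmul_eq_mul,
      ← Fintype.card_subtype, sub_nonpos]
    rw [← div_eq_mul_inv, div_le_one hdR]
    exact_mod_cast hd
  have hleft : ∑ i, (Real.negMulLog (p i) - p i * Real.log d) =
      ∑ i, Real.negMulLog (p i) - Real.log d := by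
    rw [Finset.sum_sub_distrib, ← Finset.sum_mul, hsum, one_mul]
  have hsumle := Finset.sum_le_sum fun i (_ : i ∈ Finset.univ) => hle i
  refine ⟨by linarith, fun heq i hi => ?_⟩
  by_contra hne
  have hpos : 0 < p i := lt_of_le_of_ne (hp i) (Ne.symm hi)
  have hlt : Real.negMulLog (p i) - p i * Real.log d <
      (if p i ≠ 0 then (d : ℝ)⁻¹ else 0) - p i := by
    rw [hterm i hi, if_pos hi]
    have hq : (d : ℝ)⁻¹ / p i ≠ 1 := by
      rw [Ne, div_eq_one_iff_eq hi]
      exact Ne.symm hne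
    have := mul_lt_mul_of_pos_left
      (Real.log_lt_sub_one_of_pos (div_pos (inv_pos.mpr hdR) hpos) hq) hpos
    rwa [mul_sub, mul_div_cancel₀ _ hi, mul_one] at this
  have := Finset.sum_lt_sum (fun i (_ : i ∈ Finset.univ) => hle i) ⟨i, Finset.mem_univ i, hlt⟩
  linarith

theorem schmidtStrength_le {a b a' b' : ℕ} {F : Matrix (Fin a' × Fin b') (Fin a × Fin b) ℂ}
    (hF : F ≠ 0) : schmidtStrength F ≤ Real.log (min (a * a') (b * b') : ℕ) :=
  (sum_negMulLog_le_log (reducedState_eigenvalues_nonneg hF) (sum_reducedState_eigenvalues hF)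
    (card_reducedState_eigenvalues_ne_zero_le F)).1

theorem sum_negMulLog_eq_neg_log {ι : Type*} [Fintype ι] {p : ι → ℝ} {c : ℝ}
    (hsum : ∑ i, p i = 1) (hc : ∀ i, p i ≠ 0 → p i = c) :
    ∑ i, Real.negMulLog (p i) = -Real.log c := by
  have h : ∀ i, Real.negMulLog (p i) = p i * -Real.log c := fun i => by
    by_cases hi : p i = 0
    · simp [hi]
    · rw [Real.negMulLog, hc i hi]; ring
  rw [Finset.sum_congr rfl fun i _ => h i, ← Finset.sum_mul, hsum, one_mul]

section

variable {a b a' b' r : ℕ} {F : Matrix (Fin a' × Fin b') (Fin a × Fin b) ℂ} {lam : Fin r → ℝ}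
  {A : Fin r → Matrix (Fin a') (Fin a) ℂ} {B : Fin r → Matrix (Fin b') (Fin b) ℂ}

theorem IsSchmidtDecomposition.trace_re (h : IsSchmidtDecomposition F lam A B) :
    (reshuffle F * (reshuffle F).conjTranspose).trace.re = ∑ k, lam k ^ 2 := by
  rw [h.reshuffle_mul_conjTranspose, Matrix.trace_mul_comm, ← Matrix.mul_assoc,
    vecMatrix_conjTranspose_mul h.orthonormal_right, Matrix.one_mul, Matrix.trace_diagonal,
    Complex.re_sum]
  exact Finset.sum_congr rfl fun k _ => by rw [← Complex.ofReal_pow, Complex.ofReal_re]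

theorem IsSchmidtDecomposition.ne_zero (h : IsSchmidtDecomposition F lam A B) (hr : 0 < r) :
    F ≠ 0 := by
  rintro rfl
  have h0 : reshuffle (0 : Matrix (Fin a' × Fin b') (Fin a × Fin b) ℂ) = 0 := rfl
  have := h.rank_eq
  rw [h0, Matrix.rank_zero] at this
  omega

theorem IsSchmidtDecomposition.eigenvalue_iff (h : IsSchmidtDecomposition F lam A B) (hF : F ≠ 0)
    {x : ℝ} (hx : x ≠ 0) :
    (∃ i, (reducedState_isHermitian F).eigenvalues i = x) ↔
      ∃ k, x = lam k ^ 2 / ∑ l, lam l ^ 2 := by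
  have hS := trace_reshuffle_mul_conjTranspose_pos hF
  rw [h.trace_re] at hS
  set S := ∑ l, lam l ^ 2 with hSdef
  have hρ : reducedState F = S⁻¹ • (reshuffle F * (reshuffle F).conjTranspose) := by
    rw [reducedState, h.trace_re]
  constructor
  · rintro ⟨i, hi⟩
    have hv := (reducedState_isHermitian F).mulVec_eigenvectorBasis i
    rw [hi] at hv
    set v := ((reducedState_isHermitian F).eigenvectorBasis i).ofLp with hvdef
    have hv0 : v ≠ 0 := by
      intro h0
      refine (reducedState_isHermitian F).eigenvectorBasis.orthonormal.ne_zero i ?_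
      ext j
      exact congrFun h0 j
    have hT : (reshuffle F * (reshuffle F).conjTranspose).mulVec v = ((S * x : ℝ) : ℂ) • v := by
      rw [hρ, Matrix.smul_mulVec] at hv
      have := congrArg (fun u => S • u) hv
      simp only [smul_smul, mul_inv_cancel₀ hS.ne', one_smul] at this
      rw [this]
      ext j
      simp
    obtain ⟨k, hk⟩ := (h.exists_eigenvector_iff _).mp
      ⟨by exact_mod_cast mul_ne_zero hS.ne' hx, v, hv0, hT⟩
    refine ⟨k, ?_⟩
    have hk' : S * x = lam k ^ 2 := by exact_mod_cast hk
    rw [← hk', mul_div_cancel_left₀ _ hS.ne']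
  · rintro ⟨k, hk⟩
    obtain ⟨-, w, hw, he⟩ := (h.exists_eigenvector_iff _).mpr ⟨k, rfl⟩
    -- The vector `w` is killed by `x - ρ`, which is therefore not invertible.
    have hspec : x ∈ spectrum ℝ (reducedState F) := by
      rw [spectrum.mem_iff]
      intro hu
      refine hw ((Matrix.mulVec_injective_of_isUnit hu) ?_)
      rw [Matrix.mulVec_zero, Matrix.sub_mulVec, hρ, Matrix.smul_mulVec, he, hk,
        Algebra.algebraMap_eq_smul_one, Matrix.smul_mulVec, Matrix.one_mulVec, sub_eq_zero]
      ext j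
      simp
      ring
    rw [(reducedState_isHermitian F).spectrum_real_eq_range_eigenvalues] at hspec
    exact hspec

theorem IsSchmidtDecomposition.schmidtStrength_eq (h : IsSchmidtDecomposition F lam A B)
    (hr : 0 < r) (hlam : ∀ k l, lam k = lam l) : schmidtStrength F = Real.log r := by
  have hF := h.ne_zero hr
  have hS : ∑ l, lam l ^ 2 = r * lam ⟨0, hr⟩ ^ 2 := by
    rw [Finset.sum_congr rfl fun l _ => by rw [hlam l ⟨0, hr⟩], Finset.sum_const]
    simp
  rw [schmidtStrength, vonNeumannEntropy,
    sum_negMulLog_eq_neg_log (c := (r : ℝ)⁻¹) (sum_reducedState_eigenvalues hF), Real.log_inv,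
    neg_neg]
  intro i hi
  obtain ⟨k, hk⟩ := (h.eigenvalue_iff hF hi).mp ⟨i, rfl⟩
  have h0 := (h.pos ⟨0, hr⟩).ne'
  have hr' : (r : ℝ) ≠ 0 := by exact_mod_cast hr.ne'
  rw [hk, hS, hlam k ⟨0, hr⟩]
  field_simp

/-- Equality in Gibbs' inequality makes every nonzero eigenvalue of the reduced state equal, and
each normalized squared coefficient is such an eigenvalue. -/
theorem IsSchmidtDecomposition.coefficients_eq (h : IsSchmidtDecomposition F lam A B)
    (hF : F ≠ 0) (hs : schmidtStrength F = Real.log (min (a * a') (b * b') : ℕ)) (k l : Fin r) :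
    lam k = lam l := by
  have hS := trace_reshuffle_mul_conjTranspose_pos hF
  rw [h.trace_re] at hS
  have key : ∀ k, lam k ^ 2 / ∑ l, lam l ^ 2 = ((min (a * a') (b * b') : ℕ) : ℝ)⁻¹ := by
    intro k
    have hx : lam k ^ 2 / ∑ l, lam l ^ 2 ≠ 0 := div_ne_zero (pow_ne_zero 2 (h.pos k).ne') hS.ne'
    obtain ⟨i, hi⟩ := (h.eigenvalue_iff hF hx).mpr ⟨k, rfl⟩
    rw [← hi]
    exact (sum_negMulLog_le_log (reducedState_eigenvalues_nonneg hF)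
      (sum_reducedState_eigenvalues hF) (card_reducedState_eigenvalues_ne_zero_le F)).2 hs i
      (hi ▸ hx)
  have hkl := (key k).trans (key l).symm
  rw [div_left_inj' hS.ne'] at hkl
  exact (pow_left_inj₀ (h.pos k).le (h.pos l).le two_ne_zero).mp hkl

end

theorem exists_orthonormal_family {d c c' : ℕ} (hd : d ≤ c * c') :
    ∃ A : Fin d → Matrix (Fin c') (Fin c) ℂ,
      ∀ k l, hsInner (A k) (A l) = if k = l then 1 else 0 := by
  let e : Fin d → Fin c × Fin c' := fun k => finProdFinEquiv.symm (Fin.castLE hd k)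
  have he : ∀ k l, e k = e l ↔ k = l := fun k l =>
    finProdFinEquiv.symm.injective.eq_iff.trans (Fin.castLE_injective hd).eq_iff
  refine ⟨fun k => Matrix.single (e k).2 (e k).1 1, fun k l => ?_⟩
  rw [hsInner, Matrix.conjTranspose_single]
  by_cases hkl : k = l
  · subst hkl
    simp
  · rw [if_neg hkl]
    by_cases h2 : (e k).2 = (e l).2
    · have h1 : (e k).1 ≠ (e l).1 := fun h1 => hkl ((he k l).mp (Prod.ext h1 h2))
      rw [h2, star_one, Matrix.single_mul_single_same, Matrix.trace_single_eq_of_ne _ _ _ h1]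
    · rw [Matrix.single_mul_single_of_ne _ _ _ _ h2, Matrix.trace_zero]

/-- Shows that the entropy bound is attained, so that maximality among all operators means equality
in `schmidtStrength_le`. The witness is a flat sum over matrix units. -/
theorem exists_schmidtStrength_eq {a b a' b' : ℕ} (hd : 0 < min (a * a') (b * b')) :
    ∃ G : Matrix (Fin a' × Fin b') (Fin a × Fin b) ℂ, G ≠ 0 ∧
      schmidtStrength G = Real.log (min (a * a') (b * b') : ℕ) := by
  obtain ⟨A, hA⟩ := exists_orthonormal_family (min_le_left (a * a') (b * b'))
  obtain ⟨B, hB⟩ := exists_orthonormal_family (min_le_right (a * a') (b * b'))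
  have h : IsSchmidtDecomposition (∑ k, ((1 : ℝ) : ℂ) • (A k ⊗ₖ B k)) (fun _ => 1) A B :=
    ⟨fun _ => one_pos, hA, hB, rfl⟩
  exact ⟨_, h.ne_zero hd, h.schmidtStrength_eq hd fun _ _ => rfl⟩

theorem AreSchmidtCoefficients.isMaximallyEntangled_iff {a b a' b' : ℕ}
    {F : Matrix (Fin a' × Fin b') (Fin a × Fin b) ℂ} {lam : Fin (min (a * a') (b * b')) → ℝ}
    (h : AreSchmidtCoefficients F lam) (hd : 0 < min (a * a') (b * b')) :
    IsMaximallyEntangled F ↔ ∀ k l, lam k = lam l := by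
  obtain ⟨A, B, h⟩ := h
  constructor
  · rintro ⟨hF, hmax⟩
    obtain ⟨G, hG, hGs⟩ := exists_schmidtStrength_eq hd
    exact h.coefficients_eq hF ((schmidtStrength_le hF).antisymm (hGs ▸ hmax G hG))
  · intro hlam
    refine ⟨h.ne_zero hd, fun G hG => ?_⟩
    rw [h.schmidtStrength_eq hd hlam]
    exact schmidtStrength_le hG

/-! ### Lower bound for the communication cost -/

/-- `K` is a sum of `D` tensor products of local operators. -/
def IsKroneckerSum {a b a' b' : ℕ} (D : ℕ)
    (K : Matrix (Fin a' × Fin b') (Fin a × Fin b) ℂ) : Prop :=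
  ∃ (A : Fin D → Matrix (Fin a') (Fin a) ℂ) (B : Fin D → Matrix (Fin b') (Fin b) ℂ),
    K = ∑ i, A i ⊗ₖ B i

theorem isKroneckerSum_one (a b : ℕ) :
    IsKroneckerSum 1 (1 : Matrix (Fin a × Fin b) (Fin a × Fin b) ℂ) :=
  ⟨fun _ => 1, fun _ => 1, by simp⟩

namespace IsKroneckerSum

variable {a b a' b' D : ℕ}

theorem mul_kronecker {c e : ℕ} {K : Matrix (Fin a' × Fin b') (Fin a × Fin b) ℂ}
    (h : IsKroneckerSum D K) (E : Matrix (Fin a) (Fin c) ℂ) (G : Matrix (Fin b) (Fin e) ℂ) :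
    IsKroneckerSum D (K * (E ⊗ₖ G) : Matrix (Fin a' × Fin b') (Fin c × Fin e) ℂ) := by
  obtain ⟨A, B, rfl⟩ := h
  refine ⟨fun i => A i * E, fun i => B i * G, ?_⟩
  rw [Matrix.sum_mul]
  exact Finset.sum_congr rfl fun i _ => (Matrix.mul_kronecker_mul _ _ _ _).symm

theorem smul {K : Matrix (Fin a' × Fin b') (Fin a × Fin b) ℂ} (h : IsKroneckerSum D K) (z : ℂ) :
    IsKroneckerSum D (z • K) := by
  obtain ⟨A, B, rfl⟩ := h
  refine ⟨fun i => z • A i, B, ?_⟩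
  rw [Finset.smul_sum]
  exact Finset.sum_congr rfl fun i _ => (Matrix.smul_kronecker _ _ _).symm

/-- The identity on the transmitted qudit is resolved over its `d` basis states: Alice's factor
tests her digit, and Bob's factor has the same digit inserted. A new index encodes a digit together
with an old index. -/
theorem submatrix_regroup {d : ℕ} {K : Matrix (Fin a' × Fin b') (Fin a × Fin (d * b)) ℂ}
    (h : IsKroneckerSum D K) : IsKroneckerSum (d * D) (K.submatrix id (regroup a d b)) := by
  obtain ⟨A, B, rfl⟩ := h
  refine ⟨fun i => Matrix.of fun x α => if (finProdFinEquiv.symm α).2 = (finProdFinEquiv.symm i).1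
      then A (finProdFinEquiv.symm i).2 x (finProdFinEquiv.symm α).1 else 0,
    fun i => Matrix.of fun y β => B (finProdFinEquiv.symm i).2 y
      (finProdFinEquiv ((finProdFinEquiv.symm i).1, β)), ?_⟩
  ext ⟨x, y⟩ ⟨α, β⟩
  rw [Matrix.submatrix_apply, Matrix.sum_apply, Matrix.sum_apply, ← finProdFinEquiv.sum_comp,
    Fintype.sum_prod_type_right]
  refine Finset.sum_congr rfl fun i _ => ?_
  simp only [Matrix.kroneckerMap_apply, Equiv.symm_apply_apply, Matrix.of_apply, ite_mul, zero_mul,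
    Finset.sum_ite_eq, Finset.mem_univ, if_true]
  rfl

theorem submatrix_regroup_symm {d : ℕ} {K : Matrix (Fin a' × Fin b') (Fin (a * d) × Fin b) ℂ}
    (h : IsKroneckerSum D K) : IsKroneckerSum (d * D) (K.submatrix id (regroup a d b).symm) := by
  obtain ⟨A, B, rfl⟩ := h
  refine ⟨fun i => Matrix.of fun x α => A (finProdFinEquiv.symm i).2 x
      (finProdFinEquiv (α, (finProdFinEquiv.symm i).1)),
    fun i => Matrix.of fun y β => if (finProdFinEquiv.symm β).1 = (finProdFinEquiv.symm i).1
      then B (finProdFinEquiv.symm i).2 y (finProdFinEquiv.symm β).2 else 0, ?_⟩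
  ext ⟨x, y⟩ ⟨α, β⟩
  rw [Matrix.submatrix_apply, Matrix.sum_apply, Matrix.sum_apply, ← finProdFinEquiv.sum_comp,
    Fintype.sum_prod_type_right]
  refine Finset.sum_congr rfl fun i _ => ?_
  simp only [Matrix.kroneckerMap_apply, Equiv.symm_apply_apply, Matrix.of_apply, mul_ite, mul_zero,
    Finset.sum_ite_eq, Finset.mem_univ, if_true]
  rfl

theorem rank_reshuffle_le {K : Matrix (Fin a' × Fin b') (Fin a × Fin b) ℂ}
    (h : IsKroneckerSum D K) : (reshuffle K).rank ≤ D := by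
  obtain ⟨A, B, rfl⟩ := h
  have := reshuffle_sum_kronecker (fun _ => 1) A B
  simp only [one_smul] at this
  rw [this, Matrix.mul_assoc]
  refine (Matrix.rank_mul_le_left _ _).trans ?_
  simpa using Matrix.rank_le_card_width (vecMatrix B)

end IsKroneckerSum

theorem Matrix.mul_reindex_mul_conjTranspose {l m n : Type*} [Fintype m] [Fintype n]
    (e : m ≃ n) (K : Matrix l n ℂ) (ρ : Matrix m m ℂ) :
    K * Matrix.reindex e e ρ * K.conjTranspose =
      K.submatrix id e * ρ * (K.submatrix id e).conjTranspose := by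
  have hρ : ρ = (Matrix.reindex e e ρ).submatrix e e := by simp
  conv_rhs => rw [hρ]
  rw [Matrix.conjTranspose_submatrix, Matrix.submatrix_mul_equiv, Matrix.submatrix_mul_equiv,
    Matrix.submatrix_id_id]

theorem finsupp_cost_single_add (d : ℕ) (t : ℕ →₀ ℕ) :
    ((Finsupp.single d 1 + t).sum fun d n => (n : ℝ) * Real.logb 2 (d : ℝ)) =
      Real.logb 2 d + t.sum fun d n => (n : ℝ) * Real.logb 2 (d : ℝ) := by
  rw [Finsupp.sum_add_index' (by simp) (by intros; push_cast; ring),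
    Finsupp.sum_single_index (by simp)]
  simp

theorem Protocol.cost_aliceSends {a' b' a b d : ℕ} (hd : 2 ≤ d) (P : Protocol a' b' a (d * b)) :
    (Protocol.aliceSends d hd P).cost = Real.logb 2 d + P.cost :=
  finsupp_cost_single_add d P.transmitted

theorem Protocol.cost_bobSends {a' b' a b d : ℕ} (hd : 2 ≤ d) (P : Protocol a' b' (a * d) b) :
    (Protocol.bobSends d hd P).cost = Real.logb 2 d + P.cost :=
  finsupp_cost_single_add d P.transmitted

/-- The operation implemented by a protocol has Kraus operators that are sums of `D` tensor
products, where `log₂ D` is the cost of the protocol. -/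
theorem Protocol.exists_kraus {a' b' a b : ℕ} (P : Protocol a' b' a b) :
    ∃ D : ℕ, 0 < D ∧ Real.logb 2 D = P.cost ∧
      ∃ (ι : Type) (_ : Fintype ι) (K : ι → Matrix (Fin a' × Fin b') (Fin a × Fin b) ℂ),
        (∀ ρ, P.run ρ = ∑ x, K x * ρ * (K x).conjTranspose) ∧ ∀ x, IsKroneckerSum D (K x) := by
  induction P with
  | done =>
    refine ⟨1, one_pos, ?_, Unit, inferInstance, fun _ => 1, fun ρ => ?_,
      fun _ => isKroneckerSum_one _ _⟩
    · simp [Protocol.cost, Protocol.transmitted]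
    · simp [Protocol.run]
  | @aliceLocal a b c E P ih =>
    obtain ⟨D, hD, hcost, ι, _, K, hK, hsum⟩ := ih
    refine ⟨D, hD, hcost, ι × Fin E.size, inferInstance,
      fun x => K x.1 * (E.kraus x.2 ⊗ₖ (1 : Matrix (Fin b) (Fin b) ℂ)),
      fun ρ => ?_, fun x => (hsum x.1).mul_kronecker _ _⟩
    rw [Protocol.run, hK, Fintype.sum_prod_type]
    refine Finset.sum_congr rfl fun x _ => ?_
    simp only [Matrix.mul_sum, Matrix.sum_mul, Matrix.conjTranspose_mul, Matrix.mul_assoc]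
  | @bobLocal a b c E P ih =>
    obtain ⟨D, hD, hcost, ι, _, K, hK, hsum⟩ := ih
    refine ⟨D, hD, hcost, ι × Fin E.size, inferInstance,
      fun x => K x.1 * ((1 : Matrix (Fin a) (Fin a) ℂ) ⊗ₖ E.kraus x.2),
      fun ρ => ?_, fun x => (hsum x.1).mul_kronecker _ _⟩
    rw [Protocol.run, hK, Fintype.sum_prod_type]
    refine Finset.sum_congr rfl fun x _ => ?_
    simp only [Matrix.mul_sum, Matrix.sum_mul, Matrix.conjTranspose_mul, Matrix.mul_assoc]
  | @aliceSends a b d hd P ih =>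
    obtain ⟨D, hD, hcost, ι, _, K, hK, hsum⟩ := ih
    refine ⟨d * D, by positivity, ?_, ι, inferInstance, fun x => (K x).submatrix id (regroup a d b),
      fun ρ => ?_, fun x => (hsum x).submatrix_regroup⟩
    · rw [Protocol.cost_aliceSends, ← hcost, Nat.cast_mul, Real.logb_mul]
      · exact_mod_cast (by omega : d ≠ 0)
      · exact_mod_cast hD.ne'
    · rw [Protocol.run, hK]
      exact Finset.sum_congr rfl fun x _ => Matrix.mul_reindex_mul_conjTranspose _ _ _
  | @bobSends a b d hd P ih =>
    obtain ⟨D, hD, hcost, ι, _, K, hK, hsum⟩ := ih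
    refine ⟨d * D, by positivity, ?_, ι, inferInstance,
      fun x => (K x).submatrix id (regroup a d b).symm,
      fun ρ => ?_, fun x => (hsum x).submatrix_regroup_symm⟩
    · rw [Protocol.cost_bobSends, ← hcost, Nat.cast_mul, Real.logb_mul]
      · exact_mod_cast (by omega : d ≠ 0)
      · exact_mod_cast hD.ne'
    · rw [Protocol.run, hK]
      exact Finset.sum_congr rfl fun x _ => Matrix.mul_reindex_mul_conjTranspose _ _ _

/-- If `∑ₓ |fₓ⟩⟨fₓ| = |u⟩⟨u|` with `u ≠ 0`, then `u` is a multiple of some `fₓ`. -/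
theorem exists_eq_smul_of_sum_mul_star {ι κ : Type*} [Fintype ι] {f : ι → κ → ℂ} {u : κ → ℂ}
    (hu : u ≠ 0) (h : ∀ p q, ∑ x, f x p * star (f x q) = u p * star (u q)) :
    ∃ (x : ι) (z : ℂ), u = z • f x := by
  obtain ⟨p₀, hp₀⟩ := Function.ne_iff.mp hu
  have hp₀ : u p₀ ≠ 0 := hp₀
  -- At `(p₀, p₀)` the hypothesis reads `∑ |f x p₀|² = |u p₀|²`, which is nonzero.
  have hex : ∃ x, f x p₀ ≠ 0 := by
    by_contra! hall
    have := h p₀ p₀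
    rw [Finset.sum_eq_zero fun x _ => by rw [hall x, zero_mul]] at this
    exact mul_ne_zero hp₀ (star_ne_zero.mpr hp₀) this.symm
  obtain ⟨x, hx⟩ := hex
  refine ⟨x, u p₀ / f x p₀, funext fun p => ?_⟩
  -- Proportionality of `f x` and `u` is the vanishing of these 2×2 minors. Expanding their squared
  -- moduli and summing gives four terms `± |u p|² |u p₀|²` that cancel.
  have hzero : ∑ x, (f x p * u p₀ - f x p₀ * u p) * star (f x p * u p₀ - f x p₀ * u p) = 0 := by
    calc _ = ∑ x, (f x p * star (f x p) * (u p₀ * star (u p₀))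
            - f x p * star (f x p₀) * (u p₀ * star (u p))
            - f x p₀ * star (f x p) * (u p * star (u p₀))
            + f x p₀ * star (f x p₀) * (u p * star (u p))) := by
          refine Finset.sum_congr rfl fun x _ => ?_
          rw [star_sub, star_mul', star_mul']
          ring
      _ = 0 := by
          rw [Finset.sum_add_distrib, Finset.sum_sub_distrib, Finset.sum_sub_distrib,
            ← Finset.sum_mul, ← Finset.sum_mul, ← Finset.sum_mul, ← Finset.sum_mul, h, h, h, h]
          ring
  have hsq : ∀ z : ℂ, z * star z = ((Complex.normSq z : ℝ) : ℂ) := fun z => Complex.mul_conj z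
  simp only [hsq] at hzero
  rw [← Complex.ofReal_sum, Complex.ofReal_eq_zero,
    Finset.sum_eq_zero_iff_of_nonneg fun _ _ => Complex.normSq_nonneg _] at hzero
  have := Complex.normSq_eq_zero.mp (hzero x (Finset.mem_univ x))
  rw [Pi.smul_apply, smul_eq_mul, div_mul_eq_mul_div, eq_div_iff hx]
  linear_combination -this

theorem Protocol.Computes.logb_rank_le_cost {a' b' a b : ℕ} {P : Protocol a' b' a b}
    {U : Matrix (Fin a' × Fin b') (Fin a × Fin b) ℂ} (hP : P.Computes U) (hU : U ≠ 0) :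
    Real.logb 2 (reshuffle U).rank ≤ P.cost := by
  obtain ⟨D, hD, hcost, ι, _, K, hK, hsum⟩ := P.exists_kraus
  -- Feeding the matrix units to both sides compares the operations entrywise; matrix units are
  -- allowed since `Computes` quantifies over all matrices, not only states.
  have hentry : ∀ p q : (Fin a' × Fin b') × (Fin a × Fin b),
      ∑ x, K x p.1 p.2 * star (K x q.1 q.2) = U p.1 p.2 * star (U q.1 q.2) := by
    intro p q
    have hVE : ∀ V : Matrix (Fin a' × Fin b') (Fin a × Fin b) ℂ,
        (V * Matrix.single p.2 q.2 (1 : ℂ) * V.conjTranspose) p.1 q.1 =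
          V p.1 p.2 * star (V q.1 q.2) := by
      intro V
      simp [Matrix.mul_apply, Matrix.single_apply, Finset.sum_ite_eq, ite_and]
    have := congrFun (congrFun ((hK (Matrix.single p.2 q.2 1)).symm.trans (hP _)) p.1) q.1
    rw [Matrix.sum_apply, hVE] at this
    simpa only [hVE] using this
  obtain ⟨x, z, hz⟩ := exists_eq_smul_of_sum_mul_star
    (f := fun x (p : (Fin a' × Fin b') × (Fin a × Fin b)) => K x p.1 p.2)
    (u := fun p => U p.1 p.2)
    (fun h => hU (Matrix.ext fun i j => congrFun h (i, j))) hentry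
  have hUK : U = z • K x := Matrix.ext fun i j => congrFun hz (i, j)
  have hrank : (reshuffle U).rank ≤ D := hUK ▸ ((hsum x).smul z).rank_reshuffle_le
  rw [← hcost]
  -- Monotonicity of the logarithm needs a positive argument; at rank `0` the convention `logb 2 0 =
  -- 0` is used.
  rcases Nat.eq_zero_or_pos (reshuffle U).rank with h0 | h0
  · rw [h0, Nat.cast_zero, Real.logb_zero]
    exact Real.logb_nonneg one_lt_two (by exact_mod_cast hD)
  · exact Real.logb_le_logb_of_le one_lt_two (by exact_mod_cast h0) (by exact_mod_cast hrank)

/-! ### Protocols attaining the bound -/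

/-- The operation `ρ ↦ W ρ W†`, for an isometry `W`. -/
def QuantumOperation.ofIsometry {a c : ℕ} (W : Matrix (Fin c) (Fin a) ℂ)
    (hW : W.conjTranspose * W = 1) : QuantumOperation a c where
  size := 1
  kraus _ := W
  trace_preserving := by simp [hW]

/-- The unitary operation that relabels the basis. -/
def QuantumOperation.relabel {a c : ℕ} (e : Fin a ≃ Fin c) : QuantumOperation a c :=
  .ofIsometry ((1 : Matrix (Fin c) (Fin c) ℂ).submatrix id e) (by
    rw [Matrix.conjTranspose_submatrix, Matrix.conjTranspose_one, ← Equiv.coe_refl,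
      Matrix.submatrix_mul_equiv, Matrix.mul_one, Matrix.submatrix_one_equiv])

theorem finProdFinEquiv_symm_one_mul {n : ℕ} (x : Fin (1 * n)) (u : Fin 1) :
    finProdFinEquiv.symm x = (u, Fin.cast (one_mul n) x) := by
  rw [Equiv.symm_apply_eq]
  ext
  simp [Subsingleton.elim u 0]

theorem finProdFinEquiv_symm_mul_one {n : ℕ} (x : Fin (n * 1)) (u : Fin 1) :
    finProdFinEquiv.symm x = (Fin.cast (mul_one n) x, u) := by
  rw [Equiv.symm_apply_eq]
  ext
  simp [Subsingleton.elim u 0]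

namespace Protocol.Computes

variable {a' b' a b : ℕ}

theorem done (a b : ℕ) : (Protocol.done : Protocol a b a b).Computes 1 := fun ρ => by
  simp [Protocol.run]

theorem aliceLocal {c : ℕ} {P : Protocol a' b' c b}
    {V : Matrix (Fin a' × Fin b') (Fin c × Fin b) ℂ} (h : P.Computes V)
    (W : Matrix (Fin c) (Fin a) ℂ) (hW : W.conjTranspose * W = 1) :
    (Protocol.aliceLocal (.ofIsometry W hW) P).Computes
      (V * (W ⊗ₖ (1 : Matrix (Fin b) (Fin b) ℂ))) := fun ρ => by
  rw [Protocol.run, h]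
  refine (congrArg (fun M => V * M * V.conjTranspose) (Fin.sum_univ_one _)).trans ?_
  simp only [QuantumOperation.ofIsometry, Matrix.conjTranspose_mul, Matrix.mul_assoc]

theorem bobLocal {c : ℕ} {P : Protocol a' b' a c}
    {V : Matrix (Fin a' × Fin b') (Fin a × Fin c) ℂ} (h : P.Computes V)
    (W : Matrix (Fin c) (Fin b) ℂ) (hW : W.conjTranspose * W = 1) :
    (Protocol.bobLocal (.ofIsometry W hW) P).Computes
      (V * ((1 : Matrix (Fin a) (Fin a) ℂ) ⊗ₖ W)) := fun ρ => by
  rw [Protocol.run, h]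
  refine (congrArg (fun M => V * M * V.conjTranspose) (Fin.sum_univ_one _)).trans ?_
  simp only [QuantumOperation.ofIsometry, Matrix.conjTranspose_mul, Matrix.mul_assoc]

theorem aliceRelabel {c : ℕ} {P : Protocol a' b' c b}
    {V : Matrix (Fin a' × Fin b') (Fin c × Fin b) ℂ} (h : P.Computes V) (e : Fin a ≃ Fin c) :
    (Protocol.aliceLocal (.relabel e) P).Computes
      (V.submatrix id fun x => (e x.1, x.2)) := by
  have hV : (V.submatrix id fun x => (e x.1, x.2)) = V *
      ((1 : Matrix (Fin c) (Fin c) ℂ).submatrix id e ⊗ₖ (1 : Matrix (Fin b) (Fin b) ℂ)) := by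
    ext x y
    simp [Matrix.mul_apply, Fintype.sum_prod_type, Matrix.one_apply]
  rw [hV]
  exact h.aliceLocal _ _

theorem bobRelabel {c : ℕ} {P : Protocol a' b' a c}
    {V : Matrix (Fin a' × Fin b') (Fin a × Fin c) ℂ} (h : P.Computes V) (e : Fin b ≃ Fin c) :
    (Protocol.bobLocal (.relabel e) P).Computes
      (V.submatrix id fun x => (x.1, e x.2)) := by
  have hV : (V.submatrix id fun x => (x.1, e x.2)) = V *
      ((1 : Matrix (Fin a) (Fin a) ℂ) ⊗ₖ (1 : Matrix (Fin c) (Fin c) ℂ).submatrix id e) := by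
    ext x y
    simp [Matrix.mul_apply, Fintype.sum_prod_type, Matrix.one_apply]
  rw [hV]
  exact h.bobLocal _ _

theorem aliceSends {d : ℕ} (hd : 2 ≤ d) {P : Protocol a' b' a (d * b)}
    {V : Matrix (Fin a' × Fin b') (Fin a × Fin (d * b)) ℂ} (h : P.Computes V) :
    (Protocol.aliceSends d hd P).Computes (V.submatrix id (regroup a d b)) := fun ρ => by
  rw [Protocol.run, h]
  exact Matrix.mul_reindex_mul_conjTranspose _ _ _

theorem bobSends {d : ℕ} (hd : 2 ≤ d) {P : Protocol a' b' (a * d) b}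
    {V : Matrix (Fin a' × Fin b') (Fin (a * d) × Fin b) ℂ} (h : P.Computes V) :
    (Protocol.bobSends d hd P).Computes (V.submatrix id (regroup a d b).symm) := fun ρ => by
  rw [Protocol.run, h]
  exact Matrix.mul_reindex_mul_conjTranspose _ _ _

/-- Alice sends her whole space to Bob. -/
theorem exists_aliceSendsAll {d : ℕ} (hd : 0 < d) {P : Protocol a' b' 1 (d * b)}
    {V : Matrix (Fin a' × Fin b') (Fin 1 × Fin (d * b)) ℂ} (h : P.Computes V) :
    ∃ Q : Protocol a' b' d b,
      Q.Computes (V.submatrix id fun x => (0, finProdFinEquiv x)) ∧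
        Q.cost = Real.logb 2 d + P.cost := by
  -- A transmission requires `2 ≤ d`. For `d = 1` a free relabelling replaces it, consistently with
  -- `logb 2 1 = 0`.
  rcases (by omega : d = 1 ∨ 2 ≤ d) with rfl | hd
  · refine ⟨_, ?_, (?_ : (Protocol.bobLocal (.relabel (finCongr (one_mul b).symm)) P).cost = _)⟩
    · convert h.bobRelabel (finCongr (one_mul b).symm) using 2
      ext x <;> simp [finProdFinEquiv]
    · simp [Protocol.cost, Protocol.transmitted]
  · refine ⟨_, ?_, (?_ : (Protocol.aliceLocal (.relabel (finCongr (one_mul d).symm))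
      (Protocol.aliceSends d hd P)).cost = _)⟩
    · convert (h.aliceSends hd).aliceRelabel (finCongr (one_mul d).symm) using 1
      ext x y
      simp [regroup, -finProdFinEquiv_symm_apply, finProdFinEquiv_symm_one_mul _ 0]
    · exact Protocol.cost_aliceSends hd P

/-- Bob sends a factor of his space to Alice, who holds nothing. -/
theorem exists_bobSendsFactor {d : ℕ} (hd : 0 < d) {P : Protocol a' b' d b}
    {V : Matrix (Fin a' × Fin b') (Fin d × Fin b) ℂ} (h : P.Computes V) :
    ∃ Q : Protocol a' b' 1 (d * b),
      Q.Computes (V.submatrix id ((Equiv.uniqueProd _ _).trans finProdFinEquiv.symm)) ∧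
        Q.cost = Real.logb 2 d + P.cost := by
  rcases (by omega : d = 1 ∨ 2 ≤ d) with rfl | hd
  · refine ⟨_, ?_, (?_ : (Protocol.bobLocal (.relabel (finCongr (one_mul b))) P).cost = _)⟩
    · convert h.bobRelabel (finCongr (one_mul b)) using 1
      ext x y
      simp [-finProdFinEquiv_symm_apply, finProdFinEquiv_symm_one_mul _ y.1]
    · simp [Protocol.cost, Protocol.transmitted]
  · refine ⟨_, ?_, (?_ : (Protocol.bobSends d hd
      (Protocol.aliceLocal (.relabel (finCongr (one_mul d))) P)).cost = _)⟩
    · convert (h.aliceRelabel (finCongr (one_mul d))).bobSends hd using 1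
      ext x y
      -- Pairing the received digit with the label of the one-dimensional space and casting back
      -- returns the digit.
      have hc := finProdFinEquiv_symm_one_mul
        (finProdFinEquiv (y.1, (finProdFinEquiv.symm y.2).1)) y.1
      rw [Equiv.symm_apply_apply, Prod.mk.injEq] at hc
      simp [regroup, -finProdFinEquiv_symm_apply, ← hc.2]
    · exact Protocol.cost_bobSends hd _

/-- Bob sends his whole space to Alice. -/
theorem exists_bobSendsAll {d : ℕ} (hd : 0 < d) {P : Protocol a' b' (a * d) 1}
    {V : Matrix (Fin a' × Fin b') (Fin (a * d) × Fin 1) ℂ} (h : P.Computes V) :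
    ∃ Q : Protocol a' b' a d,
      Q.Computes (V.submatrix id fun x => (finProdFinEquiv x, 0)) ∧
        Q.cost = Real.logb 2 d + P.cost := by
  rcases (by omega : d = 1 ∨ 2 ≤ d) with rfl | hd
  · refine ⟨_, ?_, (?_ : (Protocol.aliceLocal (.relabel (finCongr (mul_one a).symm)) P).cost = _)⟩
    · convert h.aliceRelabel (finCongr (mul_one a).symm) using 2
      ext x <;> simp [finProdFinEquiv]
    · simp [Protocol.cost, Protocol.transmitted]
  · refine ⟨_, ?_, (?_ : (Protocol.bobLocal (.relabel (finCongr (mul_one d).symm))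
      (Protocol.bobSends d hd P)).cost = _)⟩
    · convert (h.bobSends hd).bobRelabel (finCongr (mul_one d).symm) using 1
      ext x y
      simp [regroup, -finProdFinEquiv_symm_apply, finProdFinEquiv_symm_mul_one _ 0]
    · exact Protocol.cost_bobSends hd P

/-- Alice sends a factor of her space to Bob, who holds nothing. -/
theorem exists_aliceSendsFactor {d : ℕ} (hd : 0 < d) {P : Protocol a' b' a d}
    {V : Matrix (Fin a' × Fin b') (Fin a × Fin d) ℂ} (h : P.Computes V) :
    ∃ Q : Protocol a' b' (a * d) 1,
      Q.Computes (V.submatrix id ((Equiv.prodUnique _ _).trans finProdFinEquiv.symm)) ∧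
        Q.cost = Real.logb 2 d + P.cost := by
  rcases (by omega : d = 1 ∨ 2 ≤ d) with rfl | hd
  · refine ⟨_, ?_, (?_ : (Protocol.aliceLocal (.relabel (finCongr (mul_one a))) P).cost = _)⟩
    · convert h.aliceRelabel (finCongr (mul_one a)) using 1
      ext x y
      simp [-finProdFinEquiv_symm_apply, finProdFinEquiv_symm_mul_one _ y.2]
    · simp [Protocol.cost, Protocol.transmitted]
  · refine ⟨_, ?_, (?_ : (Protocol.aliceSends d hd
      (Protocol.bobLocal (.relabel (finCongr (mul_one d))) P)).cost = _)⟩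
    · convert (h.bobRelabel (finCongr (mul_one d))).aliceSends hd using 1
      ext x y
      have hc := finProdFinEquiv_symm_mul_one
        (finProdFinEquiv ((finProdFinEquiv.symm y.1).2, y.2)) y.2
      rw [Equiv.symm_apply_apply, Prod.mk.injEq] at hc
      simp [regroup, -finProdFinEquiv_symm_apply, ← hc.1]
    · exact Protocol.cost_aliceSends hd _

end Protocol.Computes

theorem conjTranspose_mul_submatrix_finProdFinEquiv {a b a' b' : ℕ}
    {U : Matrix (Fin a' × Fin b') (Fin a × Fin b) ℂ} (hU : U.conjTranspose * U = 1) :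
    (U.submatrix finProdFinEquiv.symm finProdFinEquiv.symm).conjTranspose *
      U.submatrix finProdFinEquiv.symm finProdFinEquiv.symm = 1 := by
  rw [Matrix.conjTranspose_submatrix, Matrix.submatrix_mul_equiv, hU, Matrix.submatrix_one_equiv]

/-- Alice sends her `a`-dimensional input to Bob, who applies `U` to the joint space and returns her
`a'`-dimensional output. -/
theorem exists_protocol_alice_moves {a b a' b' : ℕ} (ha : 0 < a) (ha' : 0 < a')
    {U : Matrix (Fin a' × Fin b') (Fin a × Fin b) ℂ} (hU : U.conjTranspose * U = 1) :
    ∃ P : Protocol a' b' a b, P.Computes U ∧ P.cost = Real.logb 2 (a * a' : ℕ) := by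
  -- The protocol is assembled backwards from `done`: each new step acts before those already
  -- present.
  obtain ⟨P₁, h₁, c₁⟩ := (Protocol.Computes.done a' b').exists_bobSendsFactor ha'
  obtain ⟨P, h, c⟩ := (h₁.bobLocal _
    (conjTranspose_mul_submatrix_finProdFinEquiv hU)).exists_aliceSendsAll ha
  refine ⟨P, ?_, ?_⟩
  · convert h using 1
    have hid : (id : Fin a' × Fin b' → _) = Equiv.refl _ := rfl
    rw [hid, Matrix.one_submatrix_mul]
    ext x y
    simp
  · rw [c, Nat.cast_mul, Real.logb_mul (by exact_mod_cast ha.ne') (by exact_mod_cast ha'.ne')]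
    congr 1
    refine c₁.trans ?_
    simp [Protocol.cost, Protocol.transmitted]

theorem exists_protocol_bob_moves {a b a' b' : ℕ} (hb : 0 < b) (hb' : 0 < b')
    {U : Matrix (Fin a' × Fin b') (Fin a × Fin b) ℂ} (hU : U.conjTranspose * U = 1) :
    ∃ P : Protocol a' b' a b, P.Computes U ∧ P.cost = Real.logb 2 (b * b' : ℕ) := by
  obtain ⟨P₁, h₁, c₁⟩ := (Protocol.Computes.done a' b').exists_aliceSendsFactor hb'
  obtain ⟨P, h, c⟩ := (h₁.aliceLocal _
    (conjTranspose_mul_submatrix_finProdFinEquiv hU)).exists_bobSendsAll hb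
  refine ⟨P, ?_, ?_⟩
  · convert h using 1
    have hid : (id : Fin a' × Fin b' → _) = Equiv.refl _ := rfl
    rw [hid, Matrix.one_submatrix_mul]
    ext x y
    simp
  · rw [c, Nat.cast_mul, Real.logb_mul (by exact_mod_cast hb.ne') (by exact_mod_cast hb'.ne')]
    congr 1
    refine c₁.trans ?_
    simp [Protocol.cost, Protocol.transmitted]

theorem hasMaximalCommunicationCost_of_rank {a b a' b' : ℕ} (ha : 0 < a) (hb : 0 < b)
    (ha' : 0 < a') (hb' : 0 < b') {U : Matrix (Fin a' × Fin b') (Fin a × Fin b) ℂ}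
    (hU : U.conjTranspose * U = 1) (hrank : (reshuffle U).rank = min (a * a') (b * b')) :
    HasMaximalCommunicationCost U := by
  constructor
  · rcases le_total (a * a') (b * b') with h | h
    · rw [min_eq_left h]
      exact exists_protocol_alice_moves ha ha' hU
    · rw [min_eq_right h]
      exact exists_protocol_bob_moves hb hb' hU
  · rintro c ⟨P, hP, rfl⟩
    rw [← hrank]
    refine hP.logb_rank_le_cost ?_
    rintro rfl
    rw [Matrix.mul_zero] at hU
    have := congrFun (congrFun hU (⟨0, ha⟩, ⟨0, hb⟩)) (⟨0, ha⟩, ⟨0, hb⟩)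
    simp at this

/-! ### Roots of unity and unitarity of the Fourier transform -/

/-- The primitive root of unity `exp (2πi / n)`. -/
noncomputable def unitRoot (n : ℕ) : ℂ :=
  Complex.exp (2 * (Real.pi : ℂ) * Complex.I / (n : ℂ))

theorem unitRoot_isPrimitiveRoot {n : ℕ} (hn : 0 < n) : IsPrimitiveRoot (unitRoot n) n :=
  Complex.isPrimitiveRoot_exp n hn.ne'

theorem star_unitRoot_pow_mul_self {n : ℕ} (hn : 0 < n) (p : ℕ) :
    star (unitRoot n ^ p) * unitRoot n ^ p = 1 := by
  have h : ‖unitRoot n ^ p‖ = 1 := by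
    rw [norm_pow, (unitRoot_isPrimitiveRoot hn).norm'_eq_one hn.ne', one_pow]
  refine (Complex.conj_mul' _).trans ?_
  rw [h]
  simp

theorem unitRoot_mul_pow_left {n d : ℕ} (hd : 0 < d) : unitRoot (n * d) ^ d = unitRoot n := by
  have hd' : (d : ℂ) ≠ 0 := by exact_mod_cast hd.ne'
  rw [unitRoot, unitRoot, ← Complex.exp_nat_mul, Nat.cast_mul]
  congr 1
  field_simp

theorem unitRoot_pow_mul_mod {n : ℕ} (hn : 0 < n) (j m : ℕ) :
    unitRoot n ^ (j * m) = unitRoot n ^ (j * (m % n)) := by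
  rw [pow_mul, pow_mul]
  refine pow_eq_pow_mod m ?_
  rw [← pow_mul, mul_comm, pow_mul, (unitRoot_isPrimitiveRoot hn).pow_eq_one, one_pow]

/-- Orthogonality of the characters of `ℤ/n`: for `r ≠ s` this is a geometric sum whose ratio `w ≠
1` satisfies `w ^ n = 1`. -/
theorem sum_star_unitRoot_mul {n : ℕ} (hn : 0 < n) {r s : ℕ} (hr : r < n) (hs : s < n) :
    ∑ j : Fin n, star (unitRoot n ^ (j * r : ℕ)) * unitRoot n ^ (j * s : ℕ) =
      if r = s then (n : ℂ) else 0 := by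
  by_cases hrs : r = s
  · subst hrs
    rw [if_pos rfl, Finset.sum_congr rfl fun j _ => star_unitRoot_pow_mul_self hn _]
    simp
  · rw [if_neg hrs]
    have hζ := unitRoot_isPrimitiveRoot hn
    set w := star (unitRoot n ^ r) * unitRoot n ^ s with hw
    have hterm : ∀ j : Fin n,
        star (unitRoot n ^ (j * r : ℕ)) * unitRoot n ^ (j * s : ℕ) = w ^ (j : ℕ) := fun j => by
      rw [hw, mul_pow, ← star_pow, ← pow_mul, ← pow_mul, mul_comm r, mul_comm s]
    have hw1 : w ≠ 1 := by
      intro h1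
      have h2 := star_unitRoot_pow_mul_self hn r
      have h3 : star (unitRoot n ^ r) ≠ 0 := left_ne_zero_of_mul_eq_one h2
      exact hrs (hζ.pow_inj hr hs (mul_left_cancel₀ h3 (h2.trans h1.symm)))
    have hwn : w ^ n = 1 := by
      rw [hw, mul_pow, ← star_pow, ← pow_mul, ← pow_mul, mul_comm r, mul_comm s, pow_mul, pow_mul,
        hζ.pow_eq_one, one_pow, one_pow, star_one, one_mul]
    rw [Finset.sum_congr rfl fun j _ => hterm j, Fin.sum_univ_eq_sum_range (fun j => w ^ j)]
    have := mul_geom_sum w n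
    rw [hwn, sub_self] at this
    exact (mul_eq_zero.mp this).resolve_left (sub_ne_zero.mpr hw1)

theorem bipartiteQFT_apply (M₁ M₂ N₁ N₂ : ℕ) (x : Fin N₁ × Fin N₂) (y : Fin M₁ × Fin M₂) :
    bipartiteQFT M₁ M₂ N₁ N₂ x y = ((1 / Real.sqrt ((N₁ * N₂ : ℕ) : ℝ) : ℝ) : ℂ) *
      unitRoot (N₁ * N₂) ^ (((x.1 : ℕ) * N₂ + x.2) * ((y.1 : ℕ) * M₂ + y.2)) := by
  rw [bipartiteQFT, Matrix.of_apply, unitRoot, ← Complex.exp_nat_mul]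
  congr 2
  push_cast
  ring

theorem bipartiteQFT_conjTranspose_mul {M₁ M₂ N₁ N₂ : ℕ} (hN₁ : 0 < N₁) (hN₂ : 0 < N₂)
    (hN : N₁ * N₂ = M₁ * M₂) :
    (bipartiteQFT M₁ M₂ N₁ N₂).conjTranspose * bipartiteQFT M₁ M₂ N₁ N₂ = 1 := by
  have hpos : 0 < N₁ * N₂ := Nat.mul_pos hN₁ hN₂
  have hlt : ∀ y : Fin M₁ × Fin M₂, (y.1 : ℕ) * M₂ + y.2 < N₁ * N₂ := fun y => by
    have := (finProdFinEquiv y).2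
    rw [hN]
    simpa [add_comm, mul_comm] using this
  have hinj : ∀ y z : Fin M₁ × Fin M₂,
      (y.1 : ℕ) * M₂ + y.2 = (z.1 : ℕ) * M₂ + z.2 ↔ y = z := fun y z => by
    rw [← finProdFinEquiv.apply_eq_iff_eq (x := y), Fin.ext_iff]
    simp [add_comm, mul_comm]
  ext y z
  rw [Matrix.mul_apply, Matrix.one_apply]
  calc ∑ x, (bipartiteQFT M₁ M₂ N₁ N₂).conjTranspose y x * bipartiteQFT M₁ M₂ N₁ N₂ x z
      = ∑ x : Fin N₁ × Fin N₂, ((N₁ * N₂ : ℕ) : ℂ)⁻¹ *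
          (star (unitRoot (N₁ * N₂) ^ ((finProdFinEquiv x : ℕ) * ((y.1 : ℕ) * M₂ + y.2))) *
            unitRoot (N₁ * N₂) ^ ((finProdFinEquiv x : ℕ) * ((z.1 : ℕ) * M₂ + z.2))) := by
        refine Finset.sum_congr rfl fun x _ => ?_
        have hx : (finProdFinEquiv x : ℕ) = (x.1 : ℕ) * N₂ + x.2 := by
          simp [add_comm, mul_comm]
        have hs : (((1 / Real.sqrt ((N₁ * N₂ : ℕ) : ℝ) : ℝ) : ℂ)) *
            ((1 / Real.sqrt ((N₁ * N₂ : ℕ) : ℝ) : ℝ) : ℂ) = ((N₁ * N₂ : ℕ) : ℂ)⁻¹ := by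
          rw [← Complex.ofReal_mul, div_mul_div_comm, one_mul,
            Real.mul_self_sqrt (Nat.cast_nonneg _), one_div]
          push_cast
          rfl
        rw [Matrix.conjTranspose_apply, bipartiteQFT_apply, bipartiteQFT_apply, hx, ← hs, star_mul']
        have hr : star (((1 / Real.sqrt ((N₁ * N₂ : ℕ) : ℝ) : ℝ) : ℂ)) =
            ((1 / Real.sqrt ((N₁ * N₂ : ℕ) : ℝ) : ℝ) : ℂ) := Complex.conj_ofReal _
        rw [hr]
        ring
    _ = if y = z then 1 else 0 := by
        rw [← Finset.mul_sum, finProdFinEquiv.sum_comp (fun n : Fin (N₁ * N₂) =>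
          star (unitRoot (N₁ * N₂) ^ ((n : ℕ) * ((y.1 : ℕ) * M₂ + y.2))) *
            unitRoot (N₁ * N₂) ^ ((n : ℕ) * ((z.1 : ℕ) * M₂ + z.2))),
          sum_star_unitRoot_mul hpos (hlt y) (hlt z)]
        simp only [hinj]
        split_ifs
        · exact inv_mul_cancel₀ (by exact_mod_cast hpos.ne')
        · exact mul_zero _

/-! ### Residue classes and the explicit decomposition -/

/-- The number of `m < M` with `m % n = r`, for `r < n`. -/
def residueCount (M n r : ℕ) : ℕ := M / n + if r < M % n then 1 else 0

theorem sum_ite_mod_eq {M n r : ℕ} (hr : r < n) :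
    ∑ m : Fin M, (if (m : ℕ) % n = r then (1 : ℂ) else 0) = residueCount M n r := by
  have h := Nat.count_modEq_card M (Nat.zero_lt_of_lt hr) r
  rw [Nat.mod_eq_of_lt hr, Nat.count_eq_card_filter_range] at h
  rw [Fin.sum_univ_eq_sum_range (fun m => if m % n = r then (1 : ℂ) else 0), residueCount, ← h,
    Finset.sum_boole]
  congr 2
  ext m
  simp [Nat.ModEq, Nat.mod_eq_of_lt hr]

/-- The class of `r < M` contains `r` itself. Indexing by `Fin (min n M)` thus keeps exactly the
nonempty classes. -/
theorem residueCount_pos {M n r : ℕ} (hr : r < min n M) : 0 < residueCount M n r := by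
  obtain ⟨h1, h2⟩ := lt_min_iff.mp hr
  rw [residueCount]
  rcases lt_or_ge M n with h | h
  · rw [Nat.mod_eq_of_lt h, if_pos h2]
    exact Nat.succ_pos _
  · have := Nat.div_pos h (Nat.zero_lt_of_lt h1)
    omega

section ExplicitDecomposition

variable (M₁ M₂ N₁ N₂ : ℕ)

/-- The Schmidt coefficients of the quantum Fourier transform. -/
noncomputable def qftCoefficient (i : Fin (min N₁ M₂) × Fin (min M₁ N₂)) : ℝ :=
  Real.sqrt (((N₁ : ℝ) * (M₁ : ℝ)) / ((N₁ : ℝ) * (N₂ : ℝ)) *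
    ((residueCount N₂ M₁ i.2 : ℝ) * (residueCount M₂ N₁ i.1 : ℝ)))

/-- The operators on the first factor in the decomposition of the quantum Fourier transform. -/
noncomputable def qftLeft (i : Fin (min N₁ M₂) × Fin (min M₁ N₂)) :
    Matrix (Fin N₁) (Fin M₁) ℂ :=
  Matrix.of fun j l => ((1 / Real.sqrt ((N₁ : ℝ) * (M₁ : ℝ)) : ℝ) : ℂ) *
    (unitRoot (N₁ * N₂) ^ ((j : ℕ) * l * (N₂ * M₂)) *
      (unitRoot N₁ ^ (j * i.1 : ℕ) * unitRoot M₁ ^ (l * i.2 : ℕ)))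

/-- The operators on the second factor in the decomposition of the quantum Fourier transform. -/
noncomputable def qftRight (i : Fin (min N₁ M₂) × Fin (min M₁ N₂)) :
    Matrix (Fin N₂) (Fin M₂) ℂ :=
  Matrix.of fun k m => if (m : ℕ) % N₁ = i.1 ∧ (k : ℕ) % M₁ = i.2 then
    ((1 / Real.sqrt ((residueCount N₂ M₁ i.2 : ℝ) * (residueCount M₂ N₁ i.1 : ℝ)) : ℝ) : ℂ) *
      unitRoot (N₁ * N₂) ^ (k * m : ℕ) else 0

variable {M₁ M₂ N₁ N₂}

theorem qftCoefficient_pos (hM₁ : 0 < M₁) (hN₁ : 0 < N₁) (hN₂ : 0 < N₂)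
    (i : Fin (min N₁ M₂) × Fin (min M₁ N₂)) : 0 < qftCoefficient M₁ M₂ N₁ N₂ i := by
  have h1 := residueCount_pos i.1.2
  have h2 := residueCount_pos i.2.2
  exact Real.sqrt_pos.mpr (by positivity)

theorem hsInner_eq_sum {a a' : ℕ} (C D : Matrix (Fin a') (Fin a) ℂ) :
    hsInner C D = ∑ j, ∑ l, star (C j l) * D j l := by
  rw [Finset.sum_comm]
  simp [hsInner, Matrix.trace, Matrix.mul_apply]

theorem ofReal_one_div_sqrt_mul_self {x : ℝ} (hx : 0 ≤ x) :
    star ((1 / Real.sqrt x : ℝ) : ℂ) * ((1 / Real.sqrt x : ℝ) : ℂ) = (x : ℂ)⁻¹ := by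
  have h : star ((1 / Real.sqrt x : ℝ) : ℂ) = ((1 / Real.sqrt x : ℝ) : ℂ) :=
    Complex.conj_ofReal _
  rw [h, ← Complex.ofReal_mul, div_mul_div_comm, one_mul, Real.mul_self_sqrt hx, one_div,
    Complex.ofReal_inv]

/-- The phase in `j * l` does not depend on the index, so it cancels against its conjugate. The
remaining double sum factors into two character sums. -/
theorem hsInner_qftLeft (hM₁ : 0 < M₁) (hN₁ : 0 < N₁) (hN₂ : 0 < N₂)
    (i i' : Fin (min N₁ M₂) × Fin (min M₁ N₂)) :
    hsInner (qftLeft M₁ M₂ N₁ N₂ i) (qftLeft M₁ M₂ N₁ N₂ i') = if i = i' then 1 else 0 := by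
  have hlt1 : ∀ r : Fin (min N₁ M₂), (r : ℕ) < N₁ := fun r => r.2.trans_le (min_le_left _ _)
  have hlt2 : ∀ r : Fin (min M₁ N₂), (r : ℕ) < M₁ := fun r => r.2.trans_le (min_le_left _ _)
  have hterm : ∀ j l, star (qftLeft M₁ M₂ N₁ N₂ i j l) * qftLeft M₁ M₂ N₁ N₂ i' j l =
      (((N₁ : ℝ) * (M₁ : ℝ) : ℝ) : ℂ)⁻¹ *
        ((star (unitRoot N₁ ^ (j * i.1 : ℕ)) * unitRoot N₁ ^ (j * i'.1 : ℕ)) *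
          (star (unitRoot M₁ ^ (l * i.2 : ℕ)) * unitRoot M₁ ^ (l * i'.2 : ℕ))) := by
    intro j l
    have h1 := star_unitRoot_pow_mul_self (Nat.mul_pos hN₁ hN₂) ((j : ℕ) * l * (N₂ * M₂))
    rw [← ofReal_one_div_sqrt_mul_self (by positivity : (0 : ℝ) ≤ N₁ * M₁), qftLeft, qftLeft,
      Matrix.of_apply, Matrix.of_apply, star_mul', star_mul', star_mul']
    linear_combination (star ((1 / Real.sqrt ((N₁ : ℝ) * (M₁ : ℝ)) : ℝ) : ℂ)) *
      ((1 / Real.sqrt ((N₁ : ℝ) * (M₁ : ℝ)) : ℝ) : ℂ) *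
        ((star (unitRoot N₁ ^ (j * i.1 : ℕ)) * unitRoot N₁ ^ (j * i'.1 : ℕ)) *
          (star (unitRoot M₁ ^ (l * i.2 : ℕ)) * unitRoot M₁ ^ (l * i'.2 : ℕ))) * h1
  rw [hsInner_eq_sum]
  simp only [hterm, ← Finset.mul_sum]
  rw [← Finset.sum_mul, sum_star_unitRoot_mul hN₁ (hlt1 _) (hlt1 _),
    sum_star_unitRoot_mul hM₁ (hlt2 _) (hlt2 _)]
  simp only [Prod.ext_iff, ← Fin.ext_iff]
  have h1 : (N₁ : ℂ) ≠ 0 := by exact_mod_cast hN₁.ne'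
  have h2 : (M₁ : ℂ) ≠ 0 := by exact_mod_cast hM₁.ne'
  by_cases c1 : i.1 = i'.1 <;> by_cases c2 : i.2 = i'.2 <;> simp [c1, c2]
  field_simp

/-- Distinct residue pairs give disjoint supports. On one support the entries have constant modulus,
and the support size is the product of the two class sizes. -/
theorem hsInner_qftRight (hN₁ : 0 < N₁) (hN₂ : 0 < N₂)
    (i i' : Fin (min N₁ M₂) × Fin (min M₁ N₂)) :
    hsInner (qftRight M₁ M₂ N₁ N₂ i) (qftRight M₁ M₂ N₁ N₂ i') = if i = i' then 1 else 0 := by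
  rw [hsInner_eq_sum]
  by_cases hi : i = i'
  · subst hi
    have hterm : ∀ k m, star (qftRight M₁ M₂ N₁ N₂ i k m) * qftRight M₁ M₂ N₁ N₂ i k m =
        (((residueCount N₂ M₁ i.2 : ℝ) * (residueCount M₂ N₁ i.1 : ℝ) : ℝ) : ℂ)⁻¹ *
          ((if (k : ℕ) % M₁ = i.2 then 1 else 0) * (if (m : ℕ) % N₁ = i.1 then 1 else 0)) := by
      intro k m
      rw [qftRight, Matrix.of_apply]
      have h1 := star_unitRoot_pow_mul_self (Nat.mul_pos hN₁ hN₂) (k * m)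
      by_cases c1 : (m : ℕ) % N₁ = i.1 <;> by_cases c2 : (k : ℕ) % M₁ = i.2
      · rw [if_pos ⟨c1, c2⟩, if_pos c1, if_pos c2, mul_one, mul_one, star_mul',
          ← ofReal_one_div_sqrt_mul_self (by positivity)]
        linear_combination star ((1 / Real.sqrt ((residueCount N₂ M₁ i.2 : ℝ) *
          (residueCount M₂ N₁ i.1 : ℝ)) : ℝ) : ℂ) * ((1 / Real.sqrt ((residueCount N₂ M₁ i.2 : ℝ) *
          (residueCount M₂ N₁ i.1 : ℝ)) : ℝ) : ℂ) * h1
      all_goals simp [c1, c2]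
    simp only [hterm, ← Finset.mul_sum]
    rw [← Finset.sum_mul, sum_ite_mod_eq (i.1.2.trans_le (min_le_left _ _)),
      sum_ite_mod_eq (i.2.2.trans_le (min_le_left _ _)), if_pos trivial]
    have h1 : (residueCount M₂ N₁ i.1 : ℂ) ≠ 0 := by
      exact_mod_cast (residueCount_pos i.1.2).ne'
    have h2 : (residueCount N₂ M₁ i.2 : ℂ) ≠ 0 := by
      exact_mod_cast (residueCount_pos i.2.2).ne'
    push_cast
    field_simp
  · rw [if_neg hi]
    refine Finset.sum_eq_zero fun k _ => Finset.sum_eq_zero fun m _ => ?_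
    rw [qftRight, qftRight, Matrix.of_apply, Matrix.of_apply]
    by_cases c : (m : ℕ) % N₁ = i.1 ∧ (k : ℕ) % M₁ = i.2
    · rw [if_neg (c := (m : ℕ) % N₁ = i'.1 ∧ (k : ℕ) % M₁ = i'.2), mul_zero]
      rintro ⟨c1, c2⟩
      exact hi (Prod.ext (Fin.ext (c.1.symm.trans c1)) (Fin.ext (c.2.symm.trans c2)))
    · rw [if_neg c, star_zero, zero_mul]

/-- The product in the exponent is expanded, and each cross phase, a power of a root of order `N₁`
or `M₁`, is reduced to a residue. -/
theorem bipartiteQFT_apply_eq (hM₁ : 0 < M₁) (hM₂ : 0 < M₂) (hN₁ : 0 < N₁) (hN₂ : 0 < N₂)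
    (hN : N₁ * N₂ = M₁ * M₂) (x : Fin N₁ × Fin N₂) (y : Fin M₁ × Fin M₂) :
    bipartiteQFT M₁ M₂ N₁ N₂ x y = ((1 / Real.sqrt ((N₁ * N₂ : ℕ) : ℝ) : ℝ) : ℂ) *
      (unitRoot (N₁ * N₂) ^ ((x.1 : ℕ) * y.1 * (N₂ * M₂)) *
        (unitRoot N₁ ^ ((x.1 : ℕ) * (y.2 % N₁)) * unitRoot M₁ ^ ((y.1 : ℕ) * (x.2 % M₁))) *
        unitRoot (N₁ * N₂) ^ (x.2 * y.2 : ℕ)) := by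
  have h1 : unitRoot N₁ = unitRoot (N₁ * N₂) ^ N₂ := (unitRoot_mul_pow_left hN₂).symm
  have h2 : unitRoot M₁ = unitRoot (N₁ * N₂) ^ M₂ := by
    rw [hN]; exact (unitRoot_mul_pow_left hM₂).symm
  rw [bipartiteQFT_apply, ← unitRoot_pow_mul_mod hN₁, ← unitRoot_pow_mul_mod hM₁, h1, h2,
    ← pow_mul, ← pow_mul, ← pow_add, ← pow_add, ← pow_add]
  congr 2
  ring

theorem bipartiteQFT_eq_sum (hM₁ : 0 < M₁) (hM₂ : 0 < M₂) (hN₁ : 0 < N₁) (hN₂ : 0 < N₂)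
    (hN : N₁ * N₂ = M₁ * M₂) :
    bipartiteQFT M₁ M₂ N₁ N₂ = ∑ i, (qftCoefficient M₁ M₂ N₁ N₂ i : ℂ) •
      (qftLeft M₁ M₂ N₁ N₂ i ⊗ₖ qftRight M₁ M₂ N₁ N₂ i) := by
  ext x y
  -- The only index whose right operator is nonzero at the entry `(x.2, y.2)`.
  let i₀ : Fin (min N₁ M₂) × Fin (min M₁ N₂) :=
    (⟨y.2 % N₁, lt_min (Nat.mod_lt _ hN₁) ((Nat.mod_le _ _).trans_lt y.2.2)⟩,
      ⟨x.2 % M₁, lt_min (Nat.mod_lt _ hM₁) ((Nat.mod_le _ _).trans_lt x.2.2)⟩)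
  rw [Matrix.sum_apply, Finset.sum_eq_single i₀]
  · have hp1 := residueCount_pos i₀.1.2
    have hp2 := residueCount_pos i₀.2.2
    have hcoef : (1 / Real.sqrt ((N₁ * N₂ : ℕ) : ℝ)) = qftCoefficient M₁ M₂ N₁ N₂ i₀ *
        (1 / Real.sqrt ((N₁ : ℝ) * (M₁ : ℝ))) * (1 / Real.sqrt ((residueCount N₂ M₁ i₀.2 : ℝ) *
          (residueCount M₂ N₁ i₀.1 : ℝ))) := by
      have s1 : Real.sqrt ((N₁ : ℝ) * (M₁ : ℝ)) ≠ 0 := (Real.sqrt_pos.mpr (by positivity)).ne'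
      have s2 : Real.sqrt ((residueCount N₂ M₁ i₀.2 : ℝ) * (residueCount M₂ N₁ i₀.1 : ℝ)) ≠ 0 :=
        (Real.sqrt_pos.mpr (by positivity)).ne'
      rw [qftCoefficient, Real.sqrt_mul (by positivity), Real.sqrt_div (by positivity),
        Nat.cast_mul]
      field_simp
    rw [bipartiteQFT_apply_eq hM₁ hM₂ hN₁ hN₂ hN, hcoef, Matrix.smul_apply,
      Matrix.kroneckerMap_apply, qftLeft, qftRight, Matrix.of_apply, Matrix.of_apply,
      if_pos ⟨rfl, rfl⟩, smul_eq_mul]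
    push_cast
    ring
  · intro i _ hi
    rw [Matrix.smul_apply, Matrix.kroneckerMap_apply, qftRight, Matrix.of_apply, if_neg, mul_zero,
      smul_zero]
    rintro ⟨c1, c2⟩
    exact hi (Prod.ext (Fin.ext c1.symm) (Fin.ext c2.symm))
  · exact fun h => (h (Finset.mem_univ _)).elim

theorem areSchmidtCoefficients_bipartiteQFT (hM₁ : 0 < M₁) (hM₂ : 0 < M₂) (hN₁ : 0 < N₁)
    (hN₂ : 0 < N₂) (hN : N₁ * N₂ = M₁ * M₂) {r : ℕ}
    (e : Fin r ≃ Fin (min N₁ M₂) × Fin (min M₁ N₂)) :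
    AreSchmidtCoefficients (bipartiteQFT M₁ M₂ N₁ N₂) (qftCoefficient M₁ M₂ N₁ N₂ ∘ e) :=
  areSchmidtCoefficients_of_fintype e (qftCoefficient_pos hM₁ hN₁ hN₂)
    (hsInner_qftLeft hM₁ hN₁ hN₂) (hsInner_qftRight hN₁ hN₂)
    (bipartiteQFT_eq_sum hM₁ hM₂ hN₁ hN₂ hN)

end ExplicitDecomposition

/-! ### Class sizes and the flatness condition -/

theorem residueCount_eq_of_dvd_or_lt {M n r s : ℕ} (h : n ∣ M ∨ n > M) (hr : r < min n M)
    (hs : s < min n M) : residueCount M n r = residueCount M n s := by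
  rw [residueCount, residueCount]
  rcases h with h | h
  · rw [Nat.mod_eq_zero_of_dvd h]
    simp
  · rw [Nat.mod_eq_of_lt h, if_pos (lt_min_iff.mp hr).2, if_pos (lt_min_iff.mp hs).2]

theorem residueCount_zero {M n : ℕ} (h : ¬n ∣ M) : residueCount M n 0 = M / n + 1 := by
  rw [residueCount, if_pos (Nat.pos_of_ne_zero fun h0 => h (Nat.dvd_of_mod_eq_zero h0))]

theorem residueCount_pred {M n : ℕ} (hn : 0 < n) : residueCount M n (n - 1) = M / n := by
  have := Nat.mod_lt M hn
  rw [residueCount, if_neg (by omega), add_zero]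

theorem ceil_natCast_div {M n : ℕ} (hn : 0 < n) (h : ¬n ∣ M) :
    ⌈(M : ℝ) / (n : ℝ)⌉₊ = M / n + 1 := by
  have hnR : (0 : ℝ) < n := by exact_mod_cast hn
  have h1 := Nat.div_add_mod M n
  have h2 := Nat.mod_lt M hn
  have h3 : 0 < M % n := Nat.pos_of_ne_zero fun h0 => h (Nat.dvd_of_mod_eq_zero h0)
  rw [Nat.ceil_eq_iff (Nat.succ_ne_zero _), Nat.succ_sub_one, lt_div_iff₀ hnR,
    div_le_iff₀ hnR]
  constructor
  · norm_cast
    rw [mul_comm]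
    omega
  · norm_cast
    rw [Nat.succ_mul, mul_comm (M / n)]
    omega

/-- The ceiling is attained at residue `0`, because `M % n > 0`, and the floor at residue `n - 1`,
which is an admissible index because `n ≤ M`. -/
theorem mem_ceil_floor_iff {M n : ℕ} (hn : 0 < n) (hle : n ≤ M) (h : ¬n ∣ M) (a : ℕ) :
    a ∈ ({⌈(M : ℝ) / (n : ℝ)⌉₊, ⌊(M : ℝ) / (n : ℝ)⌋₊} : Set ℕ) ↔
      ∃ r : Fin (min n M), residueCount M n r = a := by
  rw [ceil_natCast_div hn h, Nat.floor_div_eq_div, Set.mem_insert_iff, Set.mem_singleton_iff]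
  constructor
  · rintro (rfl | rfl)
    · exact ⟨⟨0, lt_min hn (hn.trans_le hle)⟩, residueCount_zero h⟩
    · exact ⟨⟨n - 1, lt_min (by omega) (by omega)⟩, residueCount_pred hn⟩
  · rintro ⟨r, rfl⟩
    rw [residueCount]
    split_ifs
    · exact Or.inl rfl
    · exact Or.inr rfl

theorem ncard_fourCoefficients_le (M₁ M₂ N₁ N₂ : ℕ) :
    (fourCoefficients M₁ M₂ N₁ N₂).ncard ≤ 4 := by
  set S : Set ℕ := {⌈(N₂ : ℝ) / (M₁ : ℝ)⌉₊, ⌊(N₂ : ℝ) / (M₁ : ℝ)⌋₊} with hS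
  set T : Set ℕ := {⌈(M₂ : ℝ) / (N₁ : ℝ)⌉₊, ⌊(M₂ : ℝ) / (N₁ : ℝ)⌋₊} with hT
  let f : ℕ × ℕ → ℝ := fun p =>
    Real.sqrt (((N₁ : ℝ) * (M₁ : ℝ)) / ((N₁ : ℝ) * (N₂ : ℝ)) * ((p.1 : ℝ) * (p.2 : ℝ)))
  have hsub : fourCoefficients M₁ M₂ N₁ N₂ ⊆ f '' (S ×ˢ T) := by
    rintro x ⟨-, a, ha, b, hb, rfl⟩
    exact ⟨(a, b), ⟨ha, hb⟩, rfl⟩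
  have hpair : ∀ a b : ℕ, ({a, b} : Set ℕ).ncard ≤ 2 := fun a b => by
    simpa using Set.ncard_insert_le a {b}
  have hfin : (S ×ˢ T).Finite := (Set.toFinite S).prod (Set.toFinite T)
  calc _ ≤ (f '' (S ×ˢ T)).ncard := Set.ncard_le_ncard hsub (hfin.image f)
    _ ≤ (S ×ˢ T).ncard := Set.ncard_image_le hfin
    _ = S.ncard * T.ncard := Set.ncard_prod
    _ ≤ 2 * 2 := Nat.mul_le_mul (hpair _ _) (hpair _ _)

theorem dvd_of_mul_eq_mul {M₁ M₂ N₁ N₂ : ℕ} (hM₁ : 0 < M₁) (hN : N₁ * N₂ = M₁ * M₂)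
    (h : M₁ ∣ N₂) : N₁ ∣ M₂ := by
  obtain ⟨t, rfl⟩ := h
  refine ⟨t, Nat.eq_of_mul_eq_mul_left hM₁ ?_⟩
  rw [← hN]
  ring

theorem lt_of_mul_eq_mul {M₁ M₂ N₁ N₂ : ℕ} (hM₂ : 0 < M₂) (hN : N₁ * N₂ = M₁ * M₂)
    (h : N₂ < M₁) : M₂ < N₁ := by
  by_contra! h'
  have h1 : N₁ * N₂ ≤ M₂ * N₂ := Nat.mul_le_mul_right _ h'
  have h2 : M₂ * N₂ < M₂ * M₁ := Nat.mul_lt_mul_of_pos_left h hM₂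
  rw [mul_comm M₂ M₁] at h2
  omega

/-- Since `N₂ / M₁ = M₂ / N₁`, both minima on the right switch sides together. -/
theorem min_mul_min {M₁ M₂ N₁ N₂ : ℕ} (hM₂ : 0 < M₂) (hN₂ : 0 < N₂)
    (hN : N₁ * N₂ = M₁ * M₂) :
    min (M₁ * N₁) (M₂ * N₂) = min N₁ M₂ * min M₁ N₂ := by
  rcases lt_or_ge N₂ M₁ with h | h
  · have h' := lt_of_mul_eq_mul hM₂ hN h
    rw [min_eq_right h.le, min_eq_right h'.le, min_eq_right (by nlinarith)]
  · have h' : N₁ ≤ M₂ := by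
      by_contra! hlt
      have := lt_of_mul_eq_mul (M₁ := N₁) (M₂ := N₂) (N₁ := M₁) (N₂ := M₂) hN₂ hN.symm hlt
      omega
    rw [min_eq_left h, min_eq_left h', min_eq_left (by nlinarith), mul_comm]

/-- The equality `N₂ / M₁ = M₂ / N₁` makes the two halves of the condition equivalent, so if one
fails, both do. -/
theorem not_flatnessCondition_iff {M₁ M₂ N₁ N₂ : ℕ} (hM₁ : 0 < M₁) (hM₂ : 0 < M₂) (hN₁ : 0 < N₁)
    (hN₂ : 0 < N₂) (hN : N₁ * N₂ = M₁ * M₂) :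
    ¬FlatnessCondition M₁ M₂ N₁ N₂ ↔ (¬M₁ ∣ N₂ ∧ M₁ ≤ N₂) ∧ (¬N₁ ∣ M₂ ∧ N₁ ≤ M₂) := by
  have hd : M₁ ∣ N₂ ↔ N₁ ∣ M₂ :=
    ⟨dvd_of_mul_eq_mul hM₁ hN, dvd_of_mul_eq_mul hN₁ hN.symm⟩
  have hl : N₂ < M₁ ↔ M₂ < N₁ := ⟨lt_of_mul_eq_mul hM₂ hN, lt_of_mul_eq_mul hN₂ hN.symm⟩
  rw [FlatnessCondition, hd, ← not_lt, ← not_lt, gt_iff_lt, gt_iff_lt, hl]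
  tauto

theorem qftCoefficient_eq_of_flatnessCondition {M₁ M₂ N₁ N₂ : ℕ}
    (h : FlatnessCondition M₁ M₂ N₁ N₂) (i i' : Fin (min N₁ M₂) × Fin (min M₁ N₂)) :
    qftCoefficient M₁ M₂ N₁ N₂ i = qftCoefficient M₁ M₂ N₁ N₂ i' := by
  rw [qftCoefficient, qftCoefficient, residueCount_eq_of_dvd_or_lt h.1 i.2.2 i'.2.2,
    residueCount_eq_of_dvd_or_lt h.2 i.1.2 i'.1.2]

theorem flatnessCondition_of_qftCoefficient_eq {M₁ M₂ N₁ N₂ : ℕ} (hM₁ : 0 < M₁) (hM₂ : 0 < M₂)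
    (hN₁ : 0 < N₁) (hN₂ : 0 < N₂) (hN : N₁ * N₂ = M₁ * M₂)
    (h : ∀ i i', qftCoefficient M₁ M₂ N₁ N₂ i = qftCoefficient M₁ M₂ N₁ N₂ i') :
    FlatnessCondition M₁ M₂ N₁ N₂ := by
  by_contra hflat
  obtain ⟨⟨h1, h2⟩, h3, h4⟩ := (not_flatnessCondition_iff hM₁ hM₂ hN₁ hN₂ hN).mp hflat
  -- Residues `(0, 0)` give the two ceilings and the last residues the two floors, so the largest
  -- and smallest coefficients are compared.
  have heq := h (⟨0, lt_min hN₁ hM₂⟩, ⟨0, lt_min hM₁ hN₂⟩)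
    (⟨N₁ - 1, lt_min (by omega) (by omega)⟩, ⟨M₁ - 1, lt_min (by omega) (by omega)⟩)
  have hc : (0 : ℝ) < ((N₁ : ℝ) * (M₁ : ℝ)) / ((N₁ : ℝ) * (N₂ : ℝ)) := by positivity
  rw [qftCoefficient, qftCoefficient, Real.sqrt_inj (by positivity) (by positivity),
    mul_right_inj' hc.ne'] at heq
  simp only [residueCount_zero h1, residueCount_zero h3, residueCount_pred hM₁,
    residueCount_pred hN₁] at heq
  norm_cast at heq
  have : N₂ / M₁ * (M₂ / N₁) < (N₂ / M₁ + 1) * (M₂ / N₁ + 1) :=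
    Nat.mul_lt_mul_of_le_of_lt (Nat.le_succ _) (Nat.lt_succ_self _) (Nat.succ_pos _)
  omega

theorem range_qftCoefficient {M₁ M₂ N₁ N₂ : ℕ} (hM₁ : 0 < M₁) (hM₂ : 0 < M₂)
    (hN₁ : 0 < N₁) (hN₂ : 0 < N₂) (hN : N₁ * N₂ = M₁ * M₂)
    (h : ¬FlatnessCondition M₁ M₂ N₁ N₂) :
    Set.range (qftCoefficient M₁ M₂ N₁ N₂) = fourCoefficients M₁ M₂ N₁ N₂ := by
  obtain ⟨⟨h1, h2⟩, h3, h4⟩ := (not_flatnessCondition_iff hM₁ hM₂ hN₁ hN₂ hN).mp h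
  ext x
  constructor
  · rintro ⟨i, rfl⟩
    exact ⟨(qftCoefficient_pos hM₁ hN₁ hN₂ i).ne', _,
      (mem_ceil_floor_iff hM₁ h2 h1 _).mpr ⟨i.2, rfl⟩, _,
      (mem_ceil_floor_iff hN₁ h4 h3 _).mpr ⟨i.1, rfl⟩, rfl⟩
  · rintro ⟨-, a, ha, b, hb, rfl⟩
    obtain ⟨s, rfl⟩ := (mem_ceil_floor_iff hM₁ h2 h1 _).mp ha
    obtain ⟨r, rfl⟩ := (mem_ceil_floor_iff hN₁ h4 h3 _).mp hb
    exact ⟨(r, s), rfl⟩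

theorem corollary1 (M₁ M₂ N₁ N₂ : ℕ) (hM₁ : 0 < M₁) (hM₂ : 0 < M₂) (hN₁ : 0 < N₁) (hN₂ : 0 < N₂)
    (hN : N₁ * N₂ = M₁ * M₂) :
    -- the Schmidt number
    (∀ r : ℕ, HasSchmidtNumber (bipartiteQFT M₁ M₂ N₁ N₂) r ↔ r = min (M₁ * N₁) (M₂ * N₂)) ∧
    -- the communication cost
    HasMaximalCommunicationCost (bipartiteQFT M₁ M₂ N₁ N₂) ∧
    -- maximal entanglement, as maximality of the Schmidt strength
    (IsMaximallyEntangled (bipartiteQFT M₁ M₂ N₁ N₂) ↔ FlatnessCondition M₁ M₂ N₁ N₂) ∧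
    -- maximal entanglement, as maximal Schmidt number with equal Schmidt coefficients
    ((∀ (r : ℕ) (lam : Fin r → ℝ), AreSchmidtCoefficients (bipartiteQFT M₁ M₂ N₁ N₂) lam →
        r = min (M₁ * N₁) (M₂ * N₂) ∧ ∀ k l, lam k = lam l) ↔
      FlatnessCondition M₁ M₂ N₁ N₂) ∧
    -- the Schmidt coefficients in the remaining cases
    (¬ FlatnessCondition M₁ M₂ N₁ N₂ →
      ∀ (r : ℕ) (lam : Fin r → ℝ), AreSchmidtCoefficients (bipartiteQFT M₁ M₂ N₁ N₂) lam →
        (Set.range lam).ncard ≤ 4 ∧ Set.range lam = fourCoefficients M₁ M₂ N₁ N₂) := by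
  let e : Fin (min (M₁ * N₁) (M₂ * N₂)) ≃ Fin (min N₁ M₂) × Fin (min M₁ N₂) :=
    (finCongr (min_mul_min hM₂ hN₂ hN)).trans finProdFinEquiv.symm
  have hdec := areSchmidtCoefficients_bipartiteQFT hM₁ hM₂ hN₁ hN₂ hN e
  have hflat : (∀ k l, (qftCoefficient M₁ M₂ N₁ N₂ ∘ e) k = (qftCoefficient M₁ M₂ N₁ N₂ ∘ e) l) ↔
      FlatnessCondition M₁ M₂ N₁ N₂ := by
    refine ⟨fun h => flatnessCondition_of_qftCoefficient_eq hM₁ hM₂ hN₁ hN₂ hN fun i i' => ?_,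
      fun h k l => qftCoefficient_eq_of_flatnessCondition h _ _⟩
    simpa using h (e.symm i) (e.symm i')
  -- Carries statements about the explicit coefficients over to an arbitrary Schmidt decomposition.
  have hrange : ∀ {r : ℕ} {lam : Fin r → ℝ},
      AreSchmidtCoefficients (bipartiteQFT M₁ M₂ N₁ N₂) lam →
        Set.range lam = Set.range (qftCoefficient M₁ M₂ N₁ N₂) := fun h => by
    rw [h.range_eq hdec, e.surjective.range_comp]
  refine ⟨fun r => ⟨?_, ?_⟩, ?_, ?_, ⟨fun h => ?_, fun h r lam hlam => ⟨?_, fun k l => ?_⟩⟩,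
    fun h r lam hlam => ?_⟩
  · rintro ⟨lam, hlam⟩
    rw [← hlam.rank_eq, hdec.rank_eq]
  · rintro rfl
    exact ⟨_, hdec⟩
  · exact hasMaximalCommunicationCost_of_rank hM₁ hM₂ hN₁ hN₂
      (bipartiteQFT_conjTranspose_mul hN₁ hN₂ hN) hdec.rank_eq
  · exact (hdec.isMaximallyEntangled_iff
      (lt_min (Nat.mul_pos hM₁ hN₁) (Nat.mul_pos hM₂ hN₂))).trans hflat
  -- The universal statement is not vacuous: it is applied to the explicit decomposition.
  · exact hflat.mp (h _ _ hdec).2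
  · rw [← hlam.rank_eq, hdec.rank_eq]
  · obtain ⟨i, hi⟩ := (hrange hlam).subset ⟨k, rfl⟩
    obtain ⟨i', hi'⟩ := (hrange hlam).subset ⟨l, rfl⟩
    rw [← hi, ← hi']
    exact qftCoefficient_eq_of_flatnessCondition h i i'
  · have := (hrange hlam).trans (range_qftCoefficient hM₁ hM₂ hN₁ hN₂ hN h)
    exact ⟨this ▸ ncard_fourCoefficients_le M₁ M₂ N₁ N₂, this⟩
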